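/- Let $k$ be a commutative ring and $A$ an associative unital $k$-algebra, not necessarily commutative. Write $\otimes=\otimes_k$. All $A$-bimodules are $k$-central (both actions induce the same $k$-module structure). Consider the following categories. (1) $\underline{\mathrm{Desc}}(A/k)$, the noncommutative descent data: objects are pairs $(V,g)$, with $V$ an $A$-bimodule and $g:A\otimes V\to V\otimes A$ a homomorphism of $A\otimes A$-bimodules (with factorwise actions) such that $g_2=g_3\circ g_1$ and $\psi(g(1\otimes v))=v$ for all $v\in V$. Here $\psi(v\otimes a)=va$ and, writing $g(a\otimes v)=\sum_i v_i\otimes a_i$, one puts $g_1(b\otimes a\otimes v)=\sum_i b\otimes v_i\otimes a_i$, $g_2(a\otimes b\otimes v)=\sum_i v_i\otimes b\otimes a_i$, $g_3(a\otimes v\otimes b)=\sum_i v_i\otimes a_i\otimes b$. Morphisms $(V,g)\to(V',g')$ are bimodule maps $f$ with $(f\otimes A)\circ g=g'\circ(A\otimes f)$. (2) $\mathcal{M}^{A\otimes A}$, the right comodules over the Sweedler coring $A\otimes A$: objects are right $A$-modules $V$ with a $k$-linear map $\rho:V\to V\otimes A$ (identifying $V\otimes_A(A\otimes A)$ with $V\otimes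 A$), $\rho(v)=v_{[0]}\otimes v_{[1]}$, such that $v_{[0]}v_{[1]}=v$, $\rho(v_{[0]})\otimes v_{[1]}=v_{[0]}\otimes 1\otimes v_{[1]}$ and $\rho(va)=v_{[0]}\otimes v_{[1]}a$ for all $v\in V$, $a\in A$. Morphisms are the right $A$-linear maps compatible with $\rho$. (3) $\mathcal{YD}^{A^e}$, the right Yetter–Drinfeld $A^e$-modules, where $A^e=A\otimes A^{\mathrm{op}}$: objects are pairs $(V,\rho)$ with $V$ an $A$-bimodule and $(V,\rho)\in\mathcal{M}^{A\otimes A}$, such that $\rho(av)=v_{[0]}\otimes av_{[1]}$ and $av_{[0]}\otimes v_{[1]}=v_{[0]}a\otimes v_{[1]}$ for all $v\in V$, $a\in A$. Morphisms are the bimodule maps compatible with $\rho$. (4) $\mathcal{W}_r({}_A\mathcal{M}_A)$, the weak right center of the monoidal category $({}_A\mathcal{M}_A,\otimes_A,A)$ of $A$-bimodules: objects are pairs $(V,c_{-,V})$ with $V$ an $A$-bimodule and $c_{-,V}:-\otimes_A V\to V\otimes_A-$ a natural transformation such that $c_{A,V}$ is the canonical isomorphism $A\otimes_A V\cong V\cong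 V\otimes_A A$ and, up to associativity constraints, $c_{X\otimes_A Y,V}=(c_{X,V}\otimes_A Y)\circ(X\otimes_A c_{Y,V})$ for all bimodules $X,Y$. Morphisms $(V,c_{-,V})\to(V',c_{-,V'})$ are bimodule maps $f:V\to V'$ with $c_{X,V'}\circ(X\otimes_A f)=(f\otimes_A X)\circ c_{X,V}$ for all $X$. (5) $\mathcal{Z}_r({}_A\mathcal{M}_A)$, the right center: the full subcategory of $\mathcal{W}_r({}_A\mathcal{M}_A)$ of those objects for which $c_{-,V}$ is a natural isomorphism. Theorem. The five categories $\underline{\mathrm{Desc}}(A/k)$, $\mathcal{YD}^{A^e}$, $\mathcal{M}^{A\otimes A}$, $\mathcal{W}_r({}_A\mathcal{M}_A)$ and $\mathcal{Z}_r({}_A\mathcal{M}_A)$ are isomorphic (any two of them are related by functors in both directions whose composites equal the identity functors). If $A$ is faithfully flat as a $k$-module, each of them is equivalent to the category of $k$-modules. -/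

import Mathlib

universe u v

set_option linter.unusedSectionVars false

open CategoryTheory MonoidalCategory MulOpposite
open scoped TensorProduct

namespace BimoduleCenter

/-- Two categories are isomorphic: there are functors in both directions whose two composites are
equal to the identity functors. -/
def AreIsomorphic (C : Type*) (D : Type*) [Category* C] [Category* D] : Prop :=
  ∃ (F : C ⥤ D) (G : D ⥤ C), F ⋙ G = 𝟭 C ∧ G ⋙ F = 𝟭 D

noncomputable section

/-! ### The weak right center and the right center of a monoidal category -/

section Center

variable (C : Type*) [Category* C] [MonoidalCategory C]

/-- An object of the weak right center: an object `pt` together with a natural transformation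
`c X : X ⊗ pt ⟶ pt ⊗ X` (not required to be invertible), such that `c` at the unit object is the
canonical isomorphism and `c (X ⊗ Y) = (c X ⊗ Y) ∘ (X ⊗ c Y)` up to associativity. -/
structure WeakRightCenter where
  pt : C
  c : tensorRight pt ⟶ tensorLeft pt
  c_unit : c.app (𝟙_ C) = (λ_ pt).hom ≫ (ρ_ pt).inv
  c_tensor : ∀ X Y : C, c.app (X ⊗ Y) =
    (α_ X Y pt).hom ≫ X ◁ c.app Y ≫ (α_ X pt Y).inv ≫ c.app X ▷ Y ≫ (α_ pt X Y).hom

namespace WeakRightCenter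

variable {C}

@[ext]
structure Hom (V W : WeakRightCenter C) where
  hom : V.pt ⟶ W.pt
  comm : ∀ X : C, X ◁ hom ≫ W.c.app X = V.c.app X ≫ hom ▷ X

instance : Category (WeakRightCenter C) where
  Hom := Hom
  id V := ⟨𝟙 V.pt, fun X => by simp⟩
  comp {V W Z} f g := ⟨f.hom ≫ g.hom, fun X => by
    rw [MonoidalCategory.whiskerLeft_comp, Category.assoc, g.comm, ← Category.assoc, f.comm,
      Category.assoc, ← comp_whiskerRight]⟩
  id_comp f := Hom.ext (Category.id_comp f.hom)
  comp_id f := Hom.ext (Category.comp_id f.hom)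
  assoc f g h := Hom.ext (Category.assoc f.hom g.hom h.hom)

end WeakRightCenter

/-- The right center: the full subcategory of the weak right center on the objects whose
natural transformation is a natural isomorphism. -/
abbrev RightCenter : Type _ :=
  ObjectProperty.FullSubcategory (fun V : WeakRightCenter C => IsIso V.c)

end Center

variable (k : Type u) (A : Type v) [CommRing k] [Ring A] [Algebra k A]

/-! ### Actions on modules -/

section Actions

variable {V : Type*} [AddCommGroup V] [Module k V]

/-- The left action `v ↦ a v` as a `k`-linear endomorphism. -/
def lact [Module A V] [IsScalarTower k A V] (a : A) : V →ₗ[k] V := Algebra.lsmul k k V a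

/-- The right action `v ↦ v a` as a `k`-linear endomorphism. -/
def ract [Module Aᵐᵒᵖ V] [IsScalarTower k Aᵐᵒᵖ V] (a : A) : V →ₗ[k] V :=
  Algebra.lsmul k k V (op a)

@[simp] lemma lact_apply [Module A V] [IsScalarTower k A V] (a : A) (v : V) :
    lact k A a v = a • v := rfl

@[simp] lemma ract_apply [Module Aᵐᵒᵖ V] [IsScalarTower k Aᵐᵒᵖ V] (a : A) (v : V) :
    ract k A a v = op a • v := rfl

variable (V) in
/-- The map `ψ : V ⊗ A → V`, `v ⊗ a ↦ v a`, given by the right action. -/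
def actionMap [Module Aᵐᵒᵖ V] [IsScalarTower k Aᵐᵒᵖ V] : V ⊗[k] A →ₗ[k] V :=
  TensorProduct.lift (LinearMap.mk₂ k (fun (v : V) (a : A) => op a • v)
    (fun _ _ _ => smul_add _ _ _) (fun c v a => (ract k A a).map_smul c v)
    (fun v a b => add_smul (op a) (op b) v) (fun c v a => smul_assoc c (op a) v))

@[simp] lemma actionMap_tmul [Module Aᵐᵒᵖ V] [IsScalarTower k Aᵐᵒᵖ V] (v : V) (a : A) :
    actionMap k A V (v ⊗ₜ[k] a) = op a • v := rfl

end Actions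

/-! ### The tensor product over the (noncommutative) algebra `A` -/

section Balanced

variable (V W : Type v) [AddCommGroup V] [Module k V] [Module Aᵐᵒᵖ V]
  [AddCommGroup W] [Module k W] [Module A W]

/-- The `k`-submodule of `V ⊗ W` spanned by the elements `v a ⊗ w - v ⊗ a w`. -/
def balancing : Submodule k (V ⊗[k] W) :=
  Submodule.span k {t | ∃ (v : V) (a : A) (w : W), t = (op a • v) ⊗ₜ[k] w - v ⊗ₜ[k] (a • w)}

/-- The tensor product over `A` of a right module `V` and a left module `W`. -/
def BalTensor : Type v := (V ⊗[k] W) ⧸ balancing k A V W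

namespace BalTensor

instance : AddCommGroup (BalTensor k A V W) :=
  inferInstanceAs (AddCommGroup ((V ⊗[k] W) ⧸ balancing k A V W))

instance : Module k (BalTensor k A V W) :=
  inferInstanceAs (Module k ((V ⊗[k] W) ⧸ balancing k A V W))

variable {V W}

/-- The quotient map from the tensor product over `k` to the tensor product over `A`. -/
def proj : V ⊗[k] W →ₗ[k] BalTensor k A V W := (balancing k A V W).mkQ

/-- The element `v ⊗ w` of the tensor product over `A`, as a `k`-bilinear map. -/
def mk : V →ₗ[k] W →ₗ[k] BalTensor k A V W :=
  (TensorProduct.mk k V W).compr₂ (proj k A)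

lemma mk_smul (v : V) (a : A) (w : W) : mk k A (op a • v) w = mk k A v (a • w) :=
  (Submodule.Quotient.eq _).2 (Submodule.subset_span ⟨v, a, w, rfl⟩)

section lift

variable {k A} {P : Type*} [AddCommGroup P] [Module k P]

/-- The universal property: `A`-balanced `k`-bilinear maps factor through the tensor product. -/
def lift (f : V →ₗ[k] W →ₗ[k] P)
    (hf : ∀ (v : V) (a : A) (w : W), f (op a • v) w = f v (a • w)) :
    BalTensor k A V W →ₗ[k] P :=
  (balancing k A V W).liftQ (TensorProduct.lift f) (by
    rw [balancing, Submodule.span_le]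
    rintro _ ⟨v, a, w, rfl⟩
    simp [hf])

@[simp] lemma lift_mk (f : V →ₗ[k] W →ₗ[k] P)
    (hf : ∀ (v : V) (a : A) (w : W), f (op a • v) w = f v (a • w)) (v : V) (w : W) :
    lift f hf (mk k A v w) = f v w := rfl

lemma hom_ext {f g : BalTensor k A V W →ₗ[k] P}
    (h : ∀ v w, f (mk k A v w) = g (mk k A v w)) : f = g :=
  Submodule.linearMap_qext _ (TensorProduct.ext' h)

lemma induction {p : BalTensor k A V W → Prop} (x : BalTensor k A V W) (zero : p 0)
    (mk : ∀ v w, p (mk k A v w)) (add : ∀ x y, p x → p y → p (x + y)) : p x := by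
  obtain ⟨t, rfl⟩ : ∃ t, proj k A t = x := Submodule.mkQ_surjective _ x
  induction t using TensorProduct.induction_on with
  | zero => rw [map_zero]; exact zero
  | tmul v w => exact mk v w
  | add s t hs ht => rw [map_add]; exact add _ _ hs ht

end lift

section map

variable {k A} {V' W' : Type v} [AddCommGroup V'] [Module k V'] [Module Aᵐᵒᵖ V']
  [AddCommGroup W'] [Module k W'] [Module A W']

/-- The map `f ⊗ g` on tensor products over `A`. -/
def map (f : V →ₗ[k] V') (g : W →ₗ[k] W') (hf : ∀ (a : A) (v : V), f (op a • v) = op a • f v)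
    (hg : ∀ (a : A) (w : W), g (a • w) = a • g w) :
    BalTensor k A V W →ₗ[k] BalTensor k A V' W' :=
  lift ((mk k A).compl₁₂ f g) (fun v a w => by simp [hf, hg, mk_smul])

@[simp] lemma map_mk (f : V →ₗ[k] V') (g : W →ₗ[k] W')
    (hf : ∀ (a : A) (v : V), f (op a • v) = op a • f v)
    (hg : ∀ (a : A) (w : W), g (a • w) = a • g w) (v : V) (w : W) :
    map f g hf hg (mk k A v w) = mk k A (f v) (g w) := rfl

end map

section left

variable [Module A V] [IsScalarTower k A V] [SMulCommClass A Aᵐᵒᵖ V]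

/-- The map `v ⊗ w ↦ a v ⊗ w`. -/
def lsmul (a : A) : BalTensor k A V W →ₗ[k] BalTensor k A V W :=
  map (lact k A a) LinearMap.id (fun b v => smul_comm a (op b) v) (fun _ _ => rfl)

/-- The left action of `A` on the first factor: `a (v ⊗ w) = a v ⊗ w`. -/
instance : Module A (BalTensor k A V W) where
  smul a x := lsmul k A a x
  one_smul := LinearMap.congr_fun (f := lsmul k A (1 : A)) (g := LinearMap.id)
    (hom_ext fun v w => congrArg (fun y => mk k A y w) (one_smul A v))
  mul_smul a b := LinearMap.congr_fun (f := lsmul k A (a * b)) (g := lsmul k A a ∘ₗ lsmul k A b)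
    (hom_ext fun v w => congrArg (fun y => mk k A y w) (mul_smul a b v))
  smul_zero a := map_zero (lsmul k A a)
  smul_add a := map_add (lsmul k A a)
  add_smul a b := LinearMap.congr_fun (f := lsmul k A (a + b)) (g := lsmul k A a + lsmul k A b)
    (hom_ext fun v w => (congrArg (fun y => mk k A y w) (add_smul a b v)).trans
      (LinearMap.map_add₂ (mk k A) _ _ _))
  zero_smul := LinearMap.congr_fun (f := lsmul k A (0 : A)) (g := 0)
    (hom_ext fun v w => (congrArg (fun y => mk k A y w) (zero_smul A v)).trans
      (LinearMap.map_zero₂ (mk k A) _))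

end left

section right

variable [Module Aᵐᵒᵖ W] [IsScalarTower k Aᵐᵒᵖ W] [SMulCommClass A Aᵐᵒᵖ W]

/-- The map `v ⊗ w ↦ v ⊗ w a`. -/
def rsmul (a : Aᵐᵒᵖ) : BalTensor k A V W →ₗ[k] BalTensor k A V W :=
  map LinearMap.id (ract k A (unop a)) (fun _ _ => rfl) (fun b w => (smul_comm b a w).symm)

/-- The right action of `A` on the second factor: `(v ⊗ w) a = v ⊗ w a`. -/
instance : Module Aᵐᵒᵖ (BalTensor k A V W) where
  smul a x := rsmul k A a x
  one_smul := LinearMap.congr_fun (f := rsmul k A (1 : Aᵐᵒᵖ)) (g := LinearMap.id)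
    (hom_ext fun v w => congrArg (fun y => mk k A v y) (one_smul Aᵐᵒᵖ w))
  mul_smul a b := LinearMap.congr_fun (f := rsmul k A (a * b)) (g := rsmul k A a ∘ₗ rsmul k A b)
    (hom_ext fun v w => congrArg (fun y => mk k A v y) (mul_smul a b w))
  smul_zero a := map_zero (rsmul k A a)
  smul_add a := map_add (rsmul k A a)
  add_smul a b := LinearMap.congr_fun (f := rsmul k A (a + b)) (g := rsmul k A a + rsmul k A b)
    (hom_ext fun v w => (congrArg (fun y => mk k A v y) (add_smul a b w)).trans
      (map_add (mk k A v) _ _))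
  zero_smul := LinearMap.congr_fun (f := rsmul k A (0 : Aᵐᵒᵖ)) (g := 0)
    (hom_ext fun v w => (congrArg (fun y => mk k A v y) (zero_smul Aᵐᵒᵖ w)).trans
      (map_zero (mk k A v)))

end right

@[simp] lemma smul_mk [Module A V] [IsScalarTower k A V] [SMulCommClass A Aᵐᵒᵖ V]
    (a : A) (v : V) (w : W) : a • mk k A v w = mk k A (a • v) w := rfl

@[simp] lemma op_smul_mk [Module Aᵐᵒᵖ W] [IsScalarTower k Aᵐᵒᵖ W] [SMulCommClass A Aᵐᵒᵖ W]
    (a : Aᵐᵒᵖ) (v : V) (w : W) : a • mk k A v w = mk k A v (a • w) := rfl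

instance [Module A V] [IsScalarTower k A V] [SMulCommClass A Aᵐᵒᵖ V] :
    IsScalarTower k A (BalTensor k A V W) where
  smul_assoc c a x := by
    induction x using induction with
    | zero => simp
    | mk v w => simp
    | add x y hx hy => simp [smul_add, hx, hy]

instance [Module Aᵐᵒᵖ W] [IsScalarTower k Aᵐᵒᵖ W] [SMulCommClass A Aᵐᵒᵖ W] :
    IsScalarTower k Aᵐᵒᵖ (BalTensor k A V W) where
  smul_assoc c a x := by
    induction x using induction with
    | zero => simp
    | mk v w => simp
    | add x y hx hy => simp [smul_add, hx, hy]

instance [Module A V] [IsScalarTower k A V] [SMulCommClass A Aᵐᵒᵖ V]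
    [Module Aᵐᵒᵖ W] [IsScalarTower k Aᵐᵒᵖ W] [SMulCommClass A Aᵐᵒᵖ W] :
    SMulCommClass A Aᵐᵒᵖ (BalTensor k A V W) where
  smul_comm a b x := by
    induction x using induction with
    | zero => simp
    | mk v w => simp
    | add x y hx hy => simp [smul_add, hx, hy]

end BalTensor

end Balanced

/-! ### The monoidal category of `A`-bimodules -/

/-- An `A`-bimodule over the `k`-algebra `A`: a left and a right `A`-module structure that commute
and that induce the same `k`-module structure. -/
structure Bimodule : Type (max u (v + 1)) where
  carrier : Type v
  [addCommGroup : AddCommGroup carrier]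
  [moduleBase : Module k carrier]
  [moduleLeft : Module A carrier]
  [moduleRight : Module Aᵐᵒᵖ carrier]
  [towerLeft : IsScalarTower k A carrier]
  [towerRight : IsScalarTower k Aᵐᵒᵖ carrier]
  [smulComm : SMulCommClass A Aᵐᵒᵖ carrier]

attribute [instance] Bimodule.addCommGroup Bimodule.moduleBase Bimodule.moduleLeft
  Bimodule.moduleRight Bimodule.towerLeft Bimodule.towerRight Bimodule.smulComm

namespace Bimodule

instance : CoeSort (Bimodule k A) (Type v) := ⟨carrier⟩

variable {k A}

/-- A homomorphism of `A`-bimodules: a map that is left and right `A`-linear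
(`k`-linearity is then automatic). -/
@[ext]
structure Hom (V W : Bimodule k A) where
  toLin : V →ₗ[k] W
  map_smul_left : ∀ (a : A) (v : V), toLin (a • v) = a • toLin v
  map_smul_right : ∀ (a : A) (v : V), toLin (op a • v) = op a • toLin v

instance : Category (Bimodule k A) where
  Hom := Hom
  id V := ⟨LinearMap.id, fun _ _ => rfl, fun _ _ => rfl⟩
  comp f g := ⟨g.toLin ∘ₗ f.toLin, fun a v => by simp [f.map_smul_left, g.map_smul_left],
    fun a v => by simp [f.map_smul_right, g.map_smul_right]⟩

@[ext] lemma hom_ext {V W : Bimodule k A} {f g : V ⟶ W} (h : ∀ v, f.toLin v = g.toLin v) : f = g :=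
  Hom.ext (LinearMap.ext h)

@[simp] lemma id_toLin (V : Bimodule k A) : Hom.toLin (𝟙 V) = LinearMap.id := rfl

@[simp] lemma comp_toLin {U V W : Bimodule k A} (f : U ⟶ V) (g : V ⟶ W) :
    Hom.toLin (f ≫ g) = g.toLin ∘ₗ f.toLin := rfl

/-- The tensor product over `A` of two bimodules. -/
abbrev tensor (V W : Bimodule k A) : Bimodule k A := ⟨BalTensor k A V W⟩

/-- The bimodule `A`. -/
abbrev unit : Bimodule k A := ⟨A⟩

/-- The tensor product over `A` of two bimodule homomorphisms. -/
def tensorMap {V V' W W' : Bimodule k A} (f : V ⟶ V') (g : W ⟶ W') :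
    tensor V W ⟶ tensor V' W' where
  toLin := BalTensor.map f.toLin g.toLin f.map_smul_right g.map_smul_left
  map_smul_left a x := by
    induction x using BalTensor.induction with
    | zero => simp
    | mk v w =>
      exact congrArg (fun y => BalTensor.mk k A y (g.toLin w)) (f.map_smul_left a v)
    | add x y hx hy => rw [smul_add, map_add, map_add, smul_add, hx, hy]
  map_smul_right a x := by
    induction x using BalTensor.induction with
    | zero => simp
    | mk v w =>
      exact congrArg (fun y => BalTensor.mk k A (f.toLin v) y) (g.map_smul_right a w)
    | add x y hx hy => rw [smul_add, map_add, map_add, smul_add, hx, hy]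

/-- Two bimodule homomorphisms out of a tensor product agree if they agree on all `v ⊗ w`. -/
lemma tensor_hom_ext {V W Z : Bimodule k A} {f g : tensor V W ⟶ Z}
    (h : ∀ (v : V) (w : W), f.toLin (BalTensor.mk k A v w) = g.toLin (BalTensor.mk k A v w)) :
    f = g :=
  Hom.ext (BalTensor.hom_ext h)

lemma tensor_hom_ext₃ {U V W Z : Bimodule k A} {f g : tensor (tensor U V) W ⟶ Z}
    (h : ∀ (u : U) (v : V) (w : W),
      f.toLin (BalTensor.mk k A (V := tensor U V) (BalTensor.mk k A u v) w) =
        g.toLin (BalTensor.mk k A (V := tensor U V) (BalTensor.mk k A u v) w)) : f = g := by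
  refine tensor_hom_ext (fun x w => ?_)
  induction x using BalTensor.induction with
  | zero => simp
  | mk u v => exact h u v w
  | add x y hx hy => rw [map_add, LinearMap.add_apply, map_add, map_add, hx, hy]

lemma tensor_hom_ext₃' {U V W Z : Bimodule k A} {f g : tensor U (tensor V W) ⟶ Z}
    (h : ∀ (u : U) (v : V) (w : W),
      f.toLin (BalTensor.mk k A (W := tensor V W) u (BalTensor.mk k A v w)) =
        g.toLin (BalTensor.mk k A (W := tensor V W) u (BalTensor.mk k A v w))) : f = g := by
  refine tensor_hom_ext (fun u x => ?_)
  induction x using BalTensor.induction with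
  | zero => simp
  | mk v w => exact h u v w
  | add x y hx hy => rw [map_add, map_add, map_add, hx, hy]

/-- The associativity isomorphism `(u ⊗ v) ⊗ w ↦ u ⊗ (v ⊗ w)`. -/
def assocHom (U V W : Bimodule k A) : tensor (tensor U V) W ⟶ tensor U (tensor V W) where
  toLin := BalTensor.lift
    (BalTensor.lift
      (LinearMap.mk₂ k (fun (u : U) (v : V) =>
          BalTensor.mk k A (V := U) (W := tensor V W) u ∘ₗ BalTensor.mk k A v)
        (fun u u' v => by ext w; simp) (fun c u v => by ext w; simp)
        (fun u v v' => by ext w; simp) (fun c u v => by ext w; simp))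
      (fun u a v => by
        ext w
        exact BalTensor.mk_smul k A u a (BalTensor.mk k A v w)))
    (fun x a w => by
      induction x using BalTensor.induction with
      | zero => simp
      | mk u v =>
        exact congrArg (BalTensor.mk k A (W := tensor V W) u) (BalTensor.mk_smul k A v a w)
      | add x y hx hy => simp only [smul_add, map_add, LinearMap.add_apply, hx, hy])
  map_smul_left a x := by
    induction x using BalTensor.induction with
    | zero => simp
    | mk x w =>
      induction x using BalTensor.induction with
      | zero => simp
      | mk u v => rfl
      | add x y hx hy => simp only [smul_add, map_add, LinearMap.add_apply, hx, hy]
    | add x y hx hy => simp only [smul_add, map_add, hx, hy]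
  map_smul_right a x := by
    induction x using BalTensor.induction with
    | zero => simp
    | mk x w =>
      induction x using BalTensor.induction with
      | zero => simp
      | mk u v => rfl
      | add x y hx hy => simp only [smul_add, map_add, LinearMap.add_apply, hx, hy]
    | add x y hx hy => simp only [smul_add, map_add, hx, hy]

/-- The inverse `u ⊗ (v ⊗ w) ↦ (u ⊗ v) ⊗ w` of the associativity isomorphism. -/
def assocInv (U V W : Bimodule k A) : tensor U (tensor V W) ⟶ tensor (tensor U V) W where
  toLin := BalTensor.lift
    (LinearMap.flip (BalTensor.lift
      (LinearMap.mk₂ k (fun (v : V) (w : W) =>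
          LinearMap.flip (BalTensor.mk k A (V := tensor U V) (W := W)) w ∘ₗ
            LinearMap.flip (BalTensor.mk k A (V := U) (W := V)) v)
        (fun u u' v => by ext w; simp) (fun c u v => by ext w; simp)
        (fun u v v' => by ext w; simp) (fun c u v => by ext w; simp))
      (fun v a w => by
        ext u
        exact BalTensor.mk_smul k A (BalTensor.mk k A u v) a w)))
    (fun u a x => by
      induction x using BalTensor.induction with
      | zero => simp
      | mk v w =>
        exact congrArg (fun y => BalTensor.mk k A (V := tensor U V) y w)
          (BalTensor.mk_smul k A u a v)
      | add x y hx hy => simp only [smul_add, map_add, hx, hy])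
  map_smul_left a x := by
    induction x using BalTensor.induction with
    | zero => simp
    | mk u x =>
      induction x using BalTensor.induction with
      | zero => simp
      | mk v w => rfl
      | add x y hx hy => simp only [smul_add, map_add, hx, hy]
    | add x y hx hy => simp only [smul_add, map_add, hx, hy]
  map_smul_right a x := by
    induction x using BalTensor.induction with
    | zero => simp
    | mk u x =>
      induction x using BalTensor.induction with
      | zero => simp
      | mk v w => rfl
      | add x y hx hy => simp only [smul_add, map_add, hx, hy]
    | add x y hx hy => simp only [smul_add, map_add, hx, hy]

/-- The left unit isomorphism `a ⊗ v ↦ a v`. -/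
def leftUnitIso (V : Bimodule k A) : tensor unit V ≅ V where
  hom :=
    { toLin := BalTensor.lift (Algebra.lsmul k k V : A →ₐ[k] V →ₗ[k] V).toLinearMap
        (fun b a v => mul_smul b a v)
      map_smul_left a x := by
        induction x using BalTensor.induction with
        | zero => simp
        | mk b v => exact mul_smul a b v
        | add x y hx hy => simp only [smul_add, map_add, hx, hy]
      map_smul_right a x := by
        induction x using BalTensor.induction with
        | zero => simp
        | mk b v => exact smul_comm b (op a) v
        | add x y hx hy => simp only [smul_add, map_add, hx, hy] }
  inv :=
    { toLin := BalTensor.mk k A (V := A) 1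
      map_smul_left a v :=
        (BalTensor.mk_smul k A (1 : A) a v).symm.trans
          (congrArg (fun y => BalTensor.mk k A (V := A) y v) ((one_mul a).trans (mul_one a).symm))
      map_smul_right a v := rfl }
  hom_inv_id := tensor_hom_ext fun a v =>
    (BalTensor.mk_smul k A (1 : A) a v).symm.trans
      (congrArg (fun y => BalTensor.mk k A (V := A) y v) (one_mul a))
  inv_hom_id := hom_ext fun v => one_smul A v

/-- The right unit isomorphism `v ⊗ a ↦ v a`. -/
def rightUnitIso (V : Bimodule k A) : tensor V unit ≅ V where
  hom :=
    { toLin := BalTensor.lift (TensorProduct.curry (actionMap k A V))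
        (fun v a b => (mul_smul (op b) (op a) v).symm)
      map_smul_left a x := by
        induction x using BalTensor.induction with
        | zero => simp
        | mk v b => exact (smul_comm a (op b) v).symm
        | add x y hx hy => simp only [smul_add, map_add, hx, hy]
      map_smul_right a x := by
        induction x using BalTensor.induction with
        | zero => simp
        | mk v b => exact mul_smul (op a) (op b) v
        | add x y hx hy => simp only [smul_add, map_add, hx, hy] }
  inv :=
    { toLin := (BalTensor.mk k A (W := A)).flip 1
      map_smul_left a v := rfl
      map_smul_right a v :=
        (BalTensor.mk_smul k A v a (1 : A)).trans
          (congrArg (BalTensor.mk k A (W := A) v) ((mul_one a).trans (one_mul a).symm)) }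
  hom_inv_id := tensor_hom_ext fun v a =>
    (BalTensor.mk_smul k A v a (1 : A)).trans
      (congrArg (BalTensor.mk k A (W := A) v) (mul_one a))
  inv_hom_id := hom_ext fun v => one_smul Aᵐᵒᵖ v

/-- The monoidal category of `A`-bimodules, with the tensor product over `A` and unit `A`. -/
instance : MonoidalCategory (Bimodule k A) where
  tensorObj := tensor
  whiskerLeft V _ _ f := tensorMap (𝟙 V) f
  whiskerRight f W := tensorMap f (𝟙 W)
  tensorHom f g := tensorMap f g
  tensorUnit := unit
  associator U V W :=
    { hom := assocHom U V W
      inv := assocInv U V W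
      hom_inv_id := tensor_hom_ext₃ fun _ _ _ => rfl
      inv_hom_id := tensor_hom_ext₃' fun _ _ _ => rfl }
  leftUnitor := leftUnitIso
  rightUnitor := rightUnitIso
  tensorHom_def _ _ := tensor_hom_ext fun _ _ => rfl
  id_tensorHom_id _ _ := tensor_hom_ext fun _ _ => rfl
  tensorHom_comp_tensorHom _ _ _ _ := tensor_hom_ext fun _ _ => rfl
  whiskerLeft_id _ _ := tensor_hom_ext fun _ _ => rfl
  id_whiskerRight _ _ := tensor_hom_ext fun _ _ => rfl
  associator_naturality _ _ _ := tensor_hom_ext₃ fun _ _ _ => rfl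
  leftUnitor_naturality f := tensor_hom_ext fun a v => (f.map_smul_left a v).symm
  rightUnitor_naturality f := tensor_hom_ext fun v a => (f.map_smul_right a v).symm
  pentagon W X Y Z := by
    refine tensor_hom_ext fun t z => ?_
    induction t using BalTensor.induction with
    | zero => simp
    | mk s y =>
      induction s using BalTensor.induction with
      | zero => simp
      | mk w x => rfl
      | add s t hs ht => simp only [map_add, LinearMap.add_apply, hs, ht]
    | add s t hs ht => simp only [map_add, LinearMap.add_apply, hs, ht]
  triangle X Y := tensor_hom_ext₃ fun x a y => (BalTensor.mk_smul k A x a y).symm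

end Bimodule

/-! ### Right comodules over the Sweedler coring -/

/-- A right comodule over the Sweedler canonical coring `A ⊗ A`, where `V ⊗_A (A ⊗ A)` is
identified with `V ⊗ A`: a right `A`-module `V` with a `k`-linear map `ρ : V → V ⊗ A`,
`ρ v = ∑ v₀ ⊗ v₁`, that is counital, coassociative and right `A`-linear. -/
structure SweedlerComodule : Type (max u (v + 1)) where
  carrier : Type v
  [addCommGroup : AddCommGroup carrier]
  [moduleBase : Module k carrier]
  [moduleRight : Module Aᵐᵒᵖ carrier]
  [towerRight : IsScalarTower k Aᵐᵒᵖ carrier]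
  coact : carrier →ₗ[k] carrier ⊗[k] A
  /-- `∑ v₀ v₁ = v` -/
  counit : ∀ v, actionMap k A carrier (coact v) = v
  /-- `∑ ρ(v₀) ⊗ v₁ = ∑ v₀ ⊗ 1 ⊗ v₁` -/
  coassoc : ∀ v, coact.rTensor A (coact v) =
    ((TensorProduct.mk k carrier A).flip 1).rTensor A (coact v)
  /-- `ρ(v a) = ∑ v₀ ⊗ v₁ a` -/
  coact_smul_right : ∀ (a : A) (v : carrier),
    coact (op a • v) = (ract k A a).lTensor carrier (coact v)

attribute [instance] SweedlerComodule.addCommGroup SweedlerComodule.moduleBase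
  SweedlerComodule.moduleRight SweedlerComodule.towerRight

namespace SweedlerComodule

variable {k A}

/-- A morphism of comodules: a right `A`-linear map that is compatible with the coactions. -/
@[ext]
structure Hom (V W : SweedlerComodule k A) where
  toLin : V.carrier →ₗ[k] W.carrier
  map_smul_right : ∀ (a : A) (v : V.carrier), toLin (op a • v) = op a • toLin v
  comm : ∀ v, W.coact (toLin v) = toLin.rTensor A (V.coact v)

instance : Category (SweedlerComodule k A) where
  Hom := Hom
  id V := ⟨LinearMap.id, fun _ _ => rfl, fun v => by simp⟩
  comp f g := ⟨g.toLin ∘ₗ f.toLin, fun a v => by simp [f.map_smul_right, g.map_smul_right],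
    fun v => by simp [f.comm, g.comm, LinearMap.rTensor_comp_apply]⟩

end SweedlerComodule

/-! ### Yetter-Drinfeld modules -/

/-- A right Yetter-Drinfeld `A^e`-module: an `A`-bimodule with a coaction of the Sweedler coring
on the underlying right module, and with the two compatibility conditions. -/
structure YetterDrinfeld : Type (max u (v + 1)) extends Bimodule k A where
  coact : carrier →ₗ[k] carrier ⊗[k] A
  /-- `∑ v₀ v₁ = v` -/
  counit : ∀ v, actionMap k A carrier (coact v) = v
  /-- `∑ ρ(v₀) ⊗ v₁ = ∑ v₀ ⊗ 1 ⊗ v₁` -/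
  coassoc : ∀ v, coact.rTensor A (coact v) =
    ((TensorProduct.mk k carrier A).flip 1).rTensor A (coact v)
  /-- `ρ(v a) = ∑ v₀ ⊗ v₁ a` -/
  coact_smul_right : ∀ (a : A) (v : carrier),
    coact (op a • v) = (ract k A a).lTensor carrier (coact v)
  /-- `ρ(a v) = ∑ v₀ ⊗ a v₁` -/
  coact_smul_left : ∀ (a : A) (v : carrier),
    coact (a • v) = (lact k A a).lTensor carrier (coact v)
  /-- `∑ a v₀ ⊗ v₁ = ∑ v₀ a ⊗ v₁` -/
  lact_coact : ∀ (a : A) (v : carrier),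
    (lact k A a).rTensor A (coact v) = (ract k A a).rTensor A (coact v)

namespace YetterDrinfeld

variable {k A}

/-- A morphism of Yetter-Drinfeld modules: a bimodule map that is compatible with the coactions. -/
@[ext]
structure Hom (V W : YetterDrinfeld k A) extends
    Bimodule.Hom V.toBimodule W.toBimodule where
  comm : ∀ v, W.coact (toLin v) = toLin.rTensor A (V.coact v)

instance : Category (YetterDrinfeld k A) where
  Hom := Hom
  id V := ⟨𝟙 V.toBimodule, fun v => by simp⟩
  comp {U V W} f g :=
    { toHom := CategoryStruct.comp (X := U.toBimodule) (Y := V.toBimodule) (Z := W.toBimodule)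
        f.toHom g.toHom
      comm v := by simp [f.comm, g.comm, LinearMap.rTensor_comp_apply] }

end YetterDrinfeld

/-! ### Noncommutative descent data -/

section Descent

variable {k A} {V : Type*} [AddCommGroup V] [Module k V] (g : A ⊗[k] V →ₗ[k] V ⊗[k] A)

/-- `g₁ (b ⊗ a ⊗ v) = ∑ b ⊗ vᵢ ⊗ aᵢ`, where `g (a ⊗ v) = ∑ vᵢ ⊗ aᵢ`. -/
def descent₁ : A ⊗[k] (A ⊗[k] V) →ₗ[k] A ⊗[k] (V ⊗[k] A) := g.lTensor A

/-- `g₂ (a ⊗ b ⊗ v) = ∑ vᵢ ⊗ b ⊗ aᵢ`, where `g (a ⊗ v) = ∑ vᵢ ⊗ aᵢ`. -/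
def descent₂ : A ⊗[k] (A ⊗[k] V) →ₗ[k] V ⊗[k] (A ⊗[k] A) :=
  (TensorProduct.leftComm k A V A).toLinearMap ∘ₗ g.lTensor A ∘ₗ
    (TensorProduct.leftComm k A A V).toLinearMap

/-- `g₃ (a ⊗ v ⊗ b) = ∑ vᵢ ⊗ aᵢ ⊗ b`, where `g (a ⊗ v) = ∑ vᵢ ⊗ aᵢ`. -/
def descent₃ : A ⊗[k] (V ⊗[k] A) →ₗ[k] V ⊗[k] (A ⊗[k] A) :=
  (TensorProduct.assoc k V A A).toLinearMap ∘ₗ g.rTensor A ∘ₗ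
    (TensorProduct.assoc k A V A).symm.toLinearMap

end Descent

/-- A noncommutative descent datum: an `A`-bimodule `V` with an `A ⊗ A`-bimodule map
`g : A ⊗ V → V ⊗ A` such that `g₂ = g₃ ∘ g₁` and `ψ (g (1 ⊗ v)) = v`. The bimodule structures over
`A ⊗ A` are the factorwise ones, so linearity may be tested on the elements `b ⊗ c` of `A ⊗ A`. -/
structure DescentDatum : Type (max u (v + 1)) extends Bimodule k A where
  g : A ⊗[k] carrier →ₗ[k] carrier ⊗[k] A
  /-- `g ((b ⊗ c) x) = (b ⊗ c) g(x)` -/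
  g_left : ∀ (b c : A) (x : A ⊗[k] carrier),
    g (TensorProduct.map (lact k A b) (lact k A c) x) =
      TensorProduct.map (lact k A b) (lact k A c) (g x)
  /-- `g (x (b ⊗ c)) = g(x) (b ⊗ c)` -/
  g_right : ∀ (b c : A) (x : A ⊗[k] carrier),
    g (TensorProduct.map (ract k A b) (ract k A c) x) =
      TensorProduct.map (ract k A b) (ract k A c) (g x)
  cocycle : descent₂ g = descent₃ g ∘ₗ descent₁ g
  counit : ∀ v, actionMap k A carrier (g (1 ⊗ₜ[k] v)) = v

namespace DescentDatum

variable {k A}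

/-- A morphism of descent data: a bimodule map `f` with `(f ⊗ A) ∘ g = g' ∘ (A ⊗ f)`. -/
@[ext]
structure Hom (V W : DescentDatum k A) extends
    Bimodule.Hom V.toBimodule W.toBimodule where
  comm : toLin.rTensor A ∘ₗ V.g = W.g ∘ₗ toLin.lTensor A

instance : Category (DescentDatum k A) where
  Hom := Hom
  id V := ⟨𝟙 V.toBimodule, by simp⟩
  comp {U V W} f g :=
    { toHom := CategoryStruct.comp (X := U.toBimodule) (Y := V.toBimodule) (Z := W.toBimodule)
        f.toHom g.toHom
      comm := by
        rw [Bimodule.comp_toLin, LinearMap.rTensor_comp, LinearMap.lTensor_comp,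
          LinearMap.comp_assoc, f.comm, ← LinearMap.comp_assoc, g.comm, LinearMap.comp_assoc] }

end DescentDatum

end

end BimoduleCenter

open BimoduleCenter

/-! All five structures are encodings of one coaction `ρ(v) = v₀ ⊗ v₁`, and Yetter-Drinfeld modules
serve as the hub. Their left action is redundant: the counit applied to `ρ(a v) = v₀ ⊗ a v₁` gives
`a v = v₀ a v₁`. Conversely, on a Sweedler comodule this formula defines a left action, because
coassociativity yields `ρ(v₀ a v₁) = v₀ ⊗ a v₁` (`coact_actionMap_lTensor`). For a descent datum,
linearity over `A ⊗ A` forces `g(a ⊗ v) = a v₀ ⊗ v₁` with `ρ(v) = g(1 ⊗ v)`, and the cocycle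
condition becomes coassociativity.

For the weak center, naturality along the bimodule maps `A ⊗ A → X`, `1 ⊗ 1 ↦ x`, forces `c_X(x ⊗ v)
= v₀ ⊗ x v₁`, where `ρ` is read off at `X = A ⊗ A` through `V ⊗_A (A ⊗ A) ≅ V ⊗ A`. The tensor axiom
at two free bimodules is coassociativity, and the unit axiom is `a v = v₀ a v₁`. Each such `c` is
invertible, with inverse `v ⊗ x ↦ v₁ x ⊗ v₀`; the composites are identities by coassociativity
together with `v₀ v₁ = v` and `v₁ v₀ = v`. Hence the weak center is already the center.

If `A` is faithfully flat, `N ↦ N ⊗ A` is an equivalence from `k`-modules to comodules by faithfully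
flat descent, which does not need `A` commutative. Full faithfulness comes from the exact sequence
`0 → M → M ⊗ A → M ⊗ A ⊗ A` (`tmul_one_injective`, `amitsur_exact`), essential surjectivity from the
fact that tensoring with `A` preserves the kernel defining the coinvariants
(`coinvariantsHom_bijective`). -/

namespace BimoduleCenter

/-! ### Isomorphisms of categories -/

section AreIsomorphic

universe v₁ v₂ v₃ u₁ u₂ u₃

variable {C : Type u₁} {D : Type u₂} {E : Type u₃} [Category.{v₁} C] [Category.{v₂} D]
  [Category.{v₃} E]

lemma AreIsomorphic.symm (h : AreIsomorphic C D) : AreIsomorphic D C :=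
  let ⟨F, G, hF, hG⟩ := h
  ⟨G, F, hG, hF⟩

lemma AreIsomorphic.trans (h : AreIsomorphic C D) (h' : AreIsomorphic D E) :
    AreIsomorphic C E := by
  obtain ⟨F, G, hF, hG⟩ := h
  obtain ⟨F', G', hF', hG'⟩ := h'
  refine ⟨F ⋙ F', G' ⋙ G, ?_, ?_⟩
  · rw [Functor.assoc, ← Functor.assoc F' G' G, hF', Functor.id_comp, hF]
  · rw [Functor.assoc, ← Functor.assoc G F F', hG, Functor.id_comp, hG']

lemma AreIsomorphic.nonempty_equivalence (h : AreIsomorphic C D) : Nonempty (C ≌ D) :=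
  let ⟨F, G, hF, hG⟩ := h
  ⟨CategoryTheory.Equivalence.mk F G (eqToIso hF.symm) (eqToIso hG)⟩

/-- A fully faithful functor that is bijective on objects is an isomorphism of categories. -/
lemma AreIsomorphic.of_bijective (F : C ⥤ D) [F.Full] [F.Faithful] (obj : D → C)
    (obj_map : ∀ X, obj (F.obj X) = X) (map_obj : ∀ Y, F.obj (obj Y) = Y) :
    AreIsomorphic C D := by
  let G : D ⥤ C :=
    { obj := obj
      -- The round trip on objects is only a propositional equality, so `f` is conjugated by
      -- `eqToHom` before it is lifted along `F`.
      map {X Y} f := F.preimage (eqToHom (map_obj X) ≫ f ≫ eqToHom (map_obj Y).symm)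
      map_id X := F.map_injective (by simp)
      map_comp f g := F.map_injective (by simp) }
  refine ⟨F, G, CategoryTheory.Functor.ext obj_map fun X Y f => ?_, CategoryTheory.Functor.ext map_obj fun X Y f => ?_⟩
  · exact F.map_injective (by simp [G, eqToHom_map])
  · simp [G]

end AreIsomorphic

/-- The weak right center and the right center agree as soon as all the natural transformations
are invertible. -/
lemma areIsomorphic_rightCenter {C : Type*} [Category* C] [MonoidalCategory C]
    (h : ∀ V : WeakRightCenter C, IsIso V.c) :
    AreIsomorphic (WeakRightCenter C) (RightCenter C) :=
  ⟨ObjectProperty.lift _ (𝟭 _) h, ObjectProperty.ι _, rfl, rfl⟩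

variable {k : Type u} {A : Type v} [CommRing k] [Ring A] [Algebra k A]

/-! ### Sweedler comodules and Yetter-Drinfeld modules -/

section Coaction

variable (k A) in
/-- The map `v ⊗ b ⊗ c ↦ v ⊗ b c`. -/
noncomputable def mulLast (V : Type*) [AddCommGroup V] [Module k V] :
    (V ⊗[k] A) ⊗[k] A →ₗ[k] V ⊗[k] A :=
  (LinearMap.mul' k A).lTensor V ∘ₗ (TensorProduct.assoc k V A A).toLinearMap

variable {V : Type*} [AddCommGroup V] [Module k V]

@[simp] lemma mulLast_tmul (v : V) (b c : A) :
    mulLast k A V ((v ⊗ₜ[k] b) ⊗ₜ[k] c) = v ⊗ₜ[k] (b * c) := by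
  simp [mulLast]

lemma mulLast_insert_one (t : V ⊗[k] A) :
    mulLast k A V (((TensorProduct.mk k V A).flip 1).rTensor A t) = t := by
  induction t using TensorProduct.induction_on with
  | zero => simp
  | tmul v a => simp
  | add s t hs ht => simp only [map_add, hs, ht]

variable [Module Aᵐᵒᵖ V] [IsScalarTower k Aᵐᵒᵖ V] {ρ : V →ₗ[k] V ⊗[k] A}

/-- Right linearity of `ρ` in a form valid on all tensors, so that `ρ ⊗ A` appears and
coassociativity can be applied. -/
lemma coact_actionMap
    (smul_right : ∀ (a : A) (v : V), ρ (op a • v) = (ract k A a).lTensor V (ρ v))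
    (t : V ⊗[k] A) : ρ (actionMap k A V t) = mulLast k A V (ρ.rTensor A t) := by
  induction t using TensorProduct.induction_on with
  | zero => simp
  | tmul v a =>
    rw [actionMap_tmul, smul_right, LinearMap.rTensor_tmul]
    generalize ρ v = s
    induction s using TensorProduct.induction_on with
    | zero => simp
    | tmul v b => simp
    | add s t hs ht => simp only [map_add, TensorProduct.add_tmul, hs, ht]
  | add s t hs ht => simp only [map_add, hs, ht]

lemma rTensor_lTensor_comm {M N P Q : Type*} [AddCommGroup M] [Module k M] [AddCommGroup N]
    [Module k N] [AddCommGroup P] [Module k P] [AddCommGroup Q] [Module k Q]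
    (f : M →ₗ[k] P) (g : N →ₗ[k] Q) (t : M ⊗[k] N) :
    f.rTensor Q (g.lTensor M t) = g.lTensor P (f.rTensor N t) := by
  rw [← LinearMap.comp_apply, ← LinearMap.comp_apply, LinearMap.rTensor_comp_lTensor,
    LinearMap.lTensor_comp_rTensor]

/-- `ρ(v₀ a v₁) = v₀ ⊗ a v₁`. -/
lemma coact_actionMap_lTensor
    (coassoc : ∀ v, ρ.rTensor A (ρ v) = ((TensorProduct.mk k V A).flip 1).rTensor A (ρ v))
    (smul_right : ∀ (a : A) (v : V), ρ (op a • v) = (ract k A a).lTensor V (ρ v))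
    (a : A) (v : V) :
    ρ (actionMap k A V ((lact k A a).lTensor V (ρ v))) = (lact k A a).lTensor V (ρ v) := by
  -- Right linearity gives `v₀₀ ⊗ v₀₁ a v₁`; coassociativity replaces `v₀₁` by `1`, which the
  -- product absorbs.
  rw [coact_actionMap smul_right, rTensor_lTensor_comm, coassoc, ← rTensor_lTensor_comm,
    mulLast_insert_one]

end Coaction

namespace SweedlerComodule

variable (V : SweedlerComodule k A)

/-- The left action `a v = ∑ v₀ a v₁` on a comodule over the Sweedler coring. -/
noncomputable def leftAct : A →ₐ[k] Module.End k V.carrier :=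
  AlgHom.ofLinearMap
    { toFun a := actionMap k A V.carrier ∘ₗ (lact k A a).lTensor V.carrier ∘ₗ V.coact
      map_add' a b := by
        ext v
        simp [lact, LinearMap.lTensor_add]
      map_smul' c a := by
        ext v
        simp [lact, LinearMap.lTensor_smul] }
    (by
      ext v
      simp [lact, Module.End.one_eq_id, V.counit])
    (fun a b => by
      ext v
      change _ = actionMap k A V.carrier ((lact k A a).lTensor V.carrier (V.coact _))
      simp only [LinearMap.coe_mk, AddHom.coe_mk, LinearMap.comp_apply]
      -- Multiplicativity: since `ρ(b v) = v₀ ⊗ b v₁`, both sides are `v₀ a b v₁`.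
      rw [coact_actionMap_lTensor V.coassoc V.coact_smul_right, ← LinearMap.lTensor_comp_apply]
      congr 3
      ext x
      simp [mul_assoc])

lemma leftAct_apply (a : A) (v : V.carrier) : V.leftAct a v =
    actionMap k A V.carrier ((lact k A a).lTensor V.carrier (V.coact v)) := rfl

/-- By definition `a v₀ ⊗ v₁ = v₀₀ a v₀₁ ⊗ v₁`, and coassociativity turns `v₀₁` into `1`. -/
lemma leftAct_coact (a : A) (v : V.carrier) :
    (V.leftAct a).rTensor A (V.coact v) = (ract k A a).rTensor A (V.coact v) := by
  have h : V.leftAct a =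
    (actionMap k A V.carrier ∘ₗ (lact k A a).lTensor V.carrier) ∘ₗ V.coact := rfl
  rw [h, LinearMap.rTensor_comp_apply, V.coassoc, ← LinearMap.rTensor_comp_apply]
  congr 2
  ext w
  simp

/-- The bimodule underlying a comodule over the Sweedler coring. -/
noncomputable def toBimodule : Bimodule k A :=
  letI : Module A V.carrier := Module.compHom _ V.leftAct.toRingHom
  { carrier := V.carrier
    towerLeft := ⟨fun c a v => by
      change V.leftAct (c • a) v = c • V.leftAct a v
      rw [map_smul, LinearMap.smul_apply]⟩
    smulComm := ⟨fun a b v => by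
      change V.leftAct a (op b.unop • v) = op b.unop • V.leftAct a v
      rw [leftAct_apply, leftAct_apply, V.coact_smul_right]
      generalize V.coact v = t
      induction t using TensorProduct.induction_on with
      | zero => simp
      | tmul w c => simp [mul_smul]
      | add s t hs ht => simp only [map_add, smul_add, hs, ht]⟩ }

/-- A comodule over the Sweedler coring is a Yetter-Drinfeld module. -/
noncomputable def toYetterDrinfeld : YetterDrinfeld k A where
  toBimodule := V.toBimodule
  coact := V.coact
  counit := V.counit
  coassoc := V.coassoc
  coact_smul_right := V.coact_smul_right
  coact_smul_left a v := coact_actionMap_lTensor V.coassoc V.coact_smul_right a v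
  lact_coact := V.leftAct_coact

end SweedlerComodule

namespace YetterDrinfeld

/-- `a v = ∑ v₀ a v₁` -/
lemma smul_eq (V : YetterDrinfeld k A) (a : A) (v : V.carrier) : a • v =
    actionMap k A V.carrier ((lact k A a).lTensor V.carrier (V.coact v)) := by
  rw [← V.coact_smul_left, V.counit]

/-- The comodule underlying a Yetter-Drinfeld module. -/
abbrev toSweedlerComodule (V : YetterDrinfeld k A) : SweedlerComodule k A where
  carrier := V.carrier
  coact := V.coact
  counit := V.counit
  coassoc := V.coassoc
  coact_smul_right := V.coact_smul_right

variable (k A) in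
/-- The functor that forgets the left action. -/
def forgetLeft : YetterDrinfeld k A ⥤ SweedlerComodule k A where
  obj := toSweedlerComodule
  map f := ⟨f.toLin, f.map_smul_right, f.comm⟩

instance : (forgetLeft k A).Faithful where
  map_injective h := Hom.ext (congrArg SweedlerComodule.Hom.toLin h)

/-- Left linearity is automatic, the left action being expressed by the coaction and the right
action. -/
instance : (forgetLeft k A).Full where
  map_surjective {V W} f := ⟨⟨⟨f.toLin, fun a v => by
    let φ : V.carrier →ₗ[k] W.carrier := f.toLin
    have hf : W.coact (φ v) = φ.rTensor A (V.coact v) := f.comm v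
    change φ (a • v) = a • φ v
    rw [smul_eq, smul_eq, hf, ← rTensor_lTensor_comm]
    generalize (lact k A a).lTensor V.carrier (V.coact v) = t
    induction t using TensorProduct.induction_on with
    | zero => simp
    | tmul w c => exact f.map_smul_right c w
    | add s t hs ht => simp only [map_add, hs, ht], f.map_smul_right⟩, f.comm⟩, rfl⟩

/-- Two preimages of a comodule could differ only in the left action, and `smul_eq` determines it.
-/
lemma toSweedlerComodule_injective :
    Function.Injective (toSweedlerComodule (k := k) (A := A)) := by
  intro V W h
  have hV := V.smul_eq
  have hW := W.smul_eq
  cases V with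
  | mk B => cases W with
    | mk B' => cases B with
      | @mk V _ _ mV => cases B' with
        | @mk W _ _ mW =>
          cases h
          obtain rfl : mV = mW :=
            Module.ext' _ _ fun a v => (hV a v).trans (hW a v).symm
          rfl

lemma areIsomorphic_sweedlerComodule :
    AreIsomorphic (YetterDrinfeld k A) (SweedlerComodule k A) :=
  .of_bijective (forgetLeft k A) SweedlerComodule.toYetterDrinfeld
    -- The rebuilt left action is not definitionally the original one, but the underlying comodules
    -- agree by `rfl`.
    (fun _ => toSweedlerComodule_injective rfl) fun _ => rfl

end YetterDrinfeld

/-! ### Descent data and Yetter-Drinfeld modules -/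

section Descent

variable {V : Type*} [AddCommGroup V] [Module k V] (g : A ⊗[k] V →ₗ[k] V ⊗[k] A)

lemma descent₂_tmul (a b : A) (v : V) : descent₂ g (a ⊗ₜ (b ⊗ₜ v)) =
    TensorProduct.leftComm k A V A (b ⊗ₜ g (a ⊗ₜ v)) := by
  simp [descent₂]

/-- With `leftComm_tmul_eq`, both sides of the cocycle condition take the form `assoc` of an
`rTensor`; cancelling `assoc` at `1 ⊗ 1 ⊗ v` leaves coassociativity. -/
lemma descent₃_tmul (a : A) (t : V ⊗[k] A) : descent₃ g (a ⊗ₜ t) =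
    TensorProduct.assoc k V A A ((g ∘ₗ TensorProduct.mk k A V a).rTensor A t) := by
  induction t using TensorProduct.induction_on with
  | zero => simp
  | tmul v c => simp [descent₃]
  | add s t hs ht => simp only [map_add, TensorProduct.tmul_add, hs, ht]

lemma leftComm_tmul_eq (b : A) (t : V ⊗[k] A) : TensorProduct.leftComm k A V A (b ⊗ₜ t) =
    TensorProduct.assoc k V A A (((TensorProduct.mk k V A).flip b).rTensor A t) := by
  induction t using TensorProduct.induction_on with
  | zero => simp
  | tmul v c => simp
  | add s t hs ht => simp only [map_add, TensorProduct.tmul_add, hs, ht]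

end Descent

namespace YetterDrinfeld

variable (V : YetterDrinfeld k A)

/-- The map `a ⊗ v ↦ ∑ a v₀ ⊗ v₁`. -/
noncomputable def descentMap : A ⊗[k] V.carrier →ₗ[k] V.carrier ⊗[k] A :=
  TensorProduct.lift ((LinearMap.rTensorHom A ∘ₗ
    (Algebra.lsmul k k V.carrier : A →ₐ[k] _).toLinearMap).compl₂ V.coact)

lemma descentMap_tmul (a : A) (v : V.carrier) :
    V.descentMap (a ⊗ₜ v) = (lact k A a).rTensor A (V.coact v) := rfl

@[simp] lemma descentMap_one_tmul (v : V.carrier) : V.descentMap (1 ⊗ₜ v) = V.coact v := by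
  have h : lact k A (V := V.carrier) 1 = LinearMap.id := by
    ext w
    simp
  rw [descentMap_tmul, h, LinearMap.rTensor_id, LinearMap.id_apply]

lemma descentMap_comp_mk (a : A) :
    V.descentMap ∘ₗ TensorProduct.mk k A V.carrier a = (lact k A a).rTensor A ∘ₗ V.coact := rfl

/-- The descent datum of a Yetter-Drinfeld module. -/
noncomputable abbrev toDescentDatum : DescentDatum k A where
  toBimodule := V.toBimodule
  g := V.descentMap
  g_left b c x := by
    induction x using TensorProduct.induction_on with
    | zero => simp
    | tmul a v =>
      rw [TensorProduct.map_tmul, descentMap_tmul, descentMap_tmul, lact_apply, lact_apply,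
        V.coact_smul_left]
      generalize V.coact v = t
      induction t using TensorProduct.induction_on with
      | zero => simp
      | tmul w d => simp [mul_smul]
      | add s t hs ht => simp only [map_add, hs, ht]
    | add s t hs ht => simp only [map_add, hs, ht]
  g_right b c x := by
    induction x using TensorProduct.induction_on with
    | zero => simp
    | tmul a v =>
      have h : lact k A (V := V.carrier) (op b • a) = lact k A a ∘ₗ lact k A b := by
        ext w
        simp [mul_smul]
      -- The left side is `a b v₀ ⊗ v₁ c`; the axiom `b v₀ ⊗ v₁ = v₀ b ⊗ v₁` moves `b` to the right
      -- of `v₀`.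
      rw [TensorProduct.map_tmul, descentMap_tmul, descentMap_tmul, ract_apply, ract_apply,
        V.coact_smul_right, rTensor_lTensor_comm, h, LinearMap.rTensor_comp_apply, V.lact_coact]
      generalize V.coact v = t
      induction t using TensorProduct.induction_on with
      | zero => simp
      | tmul w d => simp [smul_comm]
      | add s t hs ht => simp only [map_add, hs, ht]
    | add s t hs ht => simp only [map_add, hs, ht]
  cocycle := by
    refine TensorProduct.ext' fun a x => ?_
    induction x using TensorProduct.induction_on with
    | zero => simp
    | tmul b v =>
      have h : ((lact k A a).rTensor A ∘ₗ V.coact) ∘ₗ lact k A b =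
          ((lact k A a).rTensor A ∘ₗ (lact k A b).lTensor V.carrier) ∘ₗ V.coact := by
        refine LinearMap.ext fun w => ?_
        simp only [LinearMap.comp_apply, lact_apply, V.coact_smul_left]
      -- Here `g₃ g₁` gives `a (b v₀)₀ ⊗ (b v₀)₁ ⊗ v₁ = a v₀₀ ⊗ b v₀₁ ⊗ v₁`, which is `a v₀ ⊗ b ⊗
      -- v₁` by coassociativity.
      rw [LinearMap.comp_apply, descent₂_tmul, descent₁, LinearMap.lTensor_tmul, descent₃_tmul,
        leftComm_tmul_eq, descentMap_tmul, descentMap_tmul, descentMap_comp_mk,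
        ← LinearMap.rTensor_comp_apply, ← LinearMap.rTensor_comp_apply, h,
        LinearMap.rTensor_comp_apply _ _ V.coact, V.coassoc, ← LinearMap.rTensor_comp_apply]
      congr 3
      ext w
      simp
    | add s t hs ht => simp only [map_add, TensorProduct.tmul_add, hs, ht]
  counit v := by rw [descentMap_one_tmul, V.counit]

end YetterDrinfeld

namespace DescentDatum

variable (V : DescentDatum k A)

/-- Linearity for `a ⊗ 1`, used on the left here and on the right in `g_tmul_right`, applies to the
same element `a ⊗ v`; comparing the results gives `a v₀ ⊗ v₁ = v₀ a ⊗ v₁`. -/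
lemma g_tmul_left (a : A) (v : V.carrier) :
    V.g (a ⊗ₜ v) = (lact k A a).rTensor A (V.g (1 ⊗ₜ v)) := by
  have h : lact k A (V := A) 1 = LinearMap.id := by
    ext w
    simp
  simpa [h, LinearMap.rTensor] using V.g_left a 1 (1 ⊗ₜ v)

lemma g_tmul_right (a : A) (v : V.carrier) :
    V.g (a ⊗ₜ v) = (ract k A a).rTensor A (V.g (1 ⊗ₜ v)) := by
  have h : ract k A (V := A) 1 = LinearMap.id := by
    ext w
    simp
  simpa [h, LinearMap.rTensor] using V.g_right a 1 (1 ⊗ₜ v)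

/-- The Yetter-Drinfeld module of a descent datum, with coaction `v ↦ g (1 ⊗ v)`. -/
noncomputable abbrev toYetterDrinfeld : YetterDrinfeld k A where
  toBimodule := V.toBimodule
  coact := V.g ∘ₗ TensorProduct.mk k A V.carrier 1
  counit := V.counit
  coassoc v := by
    have h := LinearMap.congr_fun V.cocycle (1 ⊗ₜ (1 ⊗ₜ v))
    rw [LinearMap.comp_apply, descent₂_tmul, descent₁, LinearMap.lTensor_tmul, descent₃_tmul,
      leftComm_tmul_eq] at h
    exact ((TensorProduct.assoc k _ A A).injective h).symm
  coact_smul_right a v := by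
    have h : ract k A (V := V.carrier) 1 = LinearMap.id := by
      ext w
      simp
    simpa [h, LinearMap.lTensor] using V.g_right 1 a (1 ⊗ₜ v)
  coact_smul_left a v := by
    have h : lact k A (V := V.carrier) 1 = LinearMap.id := by
      ext w
      simp
    simpa [h, LinearMap.lTensor] using V.g_left 1 a (1 ⊗ₜ v)
  lact_coact a v := (V.g_tmul_left a v).symm.trans (V.g_tmul_right a v)

lemma toDescentDatum_toYetterDrinfeld : V.toYetterDrinfeld.toDescentDatum = V := by
  have h : V.toYetterDrinfeld.descentMap = V.g :=
    TensorProduct.ext' fun a v => (V.g_tmul_left a v).symm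
  cases V
  -- The remaining fields are propositions, so equality of `g` suffices.
  exact Eq.mpr (DescentDatum.mk.injEq ..) ⟨rfl, heq_of_eq h⟩

end DescentDatum

namespace YetterDrinfeld

variable (k A) in
/-- The functor that sends a Yetter-Drinfeld module to its descent datum. -/
noncomputable def toDescent : YetterDrinfeld k A ⥤ DescentDatum k A where
  obj := toDescentDatum
  map {V W} f := ⟨f.toHom, TensorProduct.ext' fun a v => by
    let φ : V.carrier →ₗ[k] W.carrier := f.toLin
    change φ.rTensor A (V.descentMap (a ⊗ₜ v)) = W.descentMap (a ⊗ₜ φ v)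
    have h : φ ∘ₗ lact k A a = lact k A a ∘ₗ φ := LinearMap.ext (f.map_smul_left a)
    have hf : W.coact (φ v) = φ.rTensor A (V.coact v) := f.comm v
    rw [descentMap_tmul, descentMap_tmul, hf, ← LinearMap.rTensor_comp_apply, h,
      LinearMap.rTensor_comp_apply]⟩

instance : (toDescent k A).Faithful where
  map_injective h := Hom.ext (congrArg (fun f => f.toLin) h)

instance : (toDescent k A).Full where
  map_surjective {V W} f := ⟨⟨f.toHom, fun v => by
    let φ : V.carrier →ₗ[k] W.carrier := f.toLin
    have h : φ.rTensor A (V.descentMap (1 ⊗ₜ v)) = W.descentMap (1 ⊗ₜ φ v) :=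
      LinearMap.congr_fun f.comm (1 ⊗ₜ v)
    rw [descentMap_one_tmul, descentMap_one_tmul] at h
    exact h.symm⟩, rfl⟩

lemma toYetterDrinfeld_toDescentDatum (V : YetterDrinfeld k A) :
    V.toDescentDatum.toYetterDrinfeld = V := by
  have h : V.descentMap ∘ₗ TensorProduct.mk k A V.carrier 1 = V.coact :=
    LinearMap.ext V.descentMap_one_tmul
  cases V
  exact Eq.mpr (YetterDrinfeld.mk.injEq ..) ⟨rfl, heq_of_eq h⟩

lemma areIsomorphic_descentDatum :
    AreIsomorphic (YetterDrinfeld k A) (DescentDatum k A) :=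
  .of_bijective (toDescent k A) DescentDatum.toYetterDrinfeld
    toYetterDrinfeld_toDescentDatum DescentDatum.toDescentDatum_toYetterDrinfeld

end YetterDrinfeld

/-! ### Insertion maps and the free bimodule -/

namespace Bimodule

/-- The map `w ⊗ a ↦ w ⊗ x a` from `V ⊗ A` to `V ⊗_A X`. -/
noncomputable def insertRight (V : Bimodule k A) {X : Bimodule k A} :
    X →ₗ[k] V ⊗[k] A →ₗ[k] tensor V X :=
  (LinearMap.llcomp k (V ⊗[k] A) (V ⊗[k] X) (tensor V X) (BalTensor.proj k A)) ∘ₗ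
    LinearMap.lTensorHom V ∘ₗ TensorProduct.curry (actionMap k A X)

variable {V W X Y : Bimodule k A}

@[simp] lemma insertRight_tmul (x : X) (w : V) (a : A) :
    insertRight V x (w ⊗ₜ a) = BalTensor.mk k A w (op a • x) := rfl

/-- This and the next three lemmas move an action on `x` or on `V ⊗_A X` into `V ⊗ A`, where the
Yetter-Drinfeld axioms apply. -/
lemma insertRight_op_smul (a : A) (x : X) (t : V ⊗[k] A) :
    insertRight V (op a • x) t = insertRight V x ((lact k A a).lTensor V t) := by
  induction t using TensorProduct.induction_on with
  | zero => simp
  | tmul w d => exact congrArg (BalTensor.mk k A w) (mul_smul (op d) (op a) x).symm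
  | add s t hs ht => simp only [map_add, hs, ht]

lemma insertRight_smul (a : A) (x : X) (t : V ⊗[k] A) :
    insertRight V (a • x) t = insertRight V x ((ract k A a).rTensor A t) := by
  induction t using TensorProduct.induction_on with
  | zero => simp
  | tmul w d =>
    exact (congrArg (BalTensor.mk k A w) (smul_comm a (op d) x).symm).trans
      (BalTensor.mk_smul k A w a (op d • x)).symm
  | add s t hs ht => simp only [map_add, hs, ht]

lemma smul_insertRight (a : A) (x : X) (t : V ⊗[k] A) :
    a • insertRight V x t = insertRight V x ((lact k A a).rTensor A t) := by
  induction t using TensorProduct.induction_on with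
  | zero => simp
  | tmul w d => rfl
  | add s t hs ht => simp only [map_add, smul_add, hs, ht]

lemma op_smul_insertRight (a : A) (x : X) (t : V ⊗[k] A) :
    op a • insertRight V x t = insertRight V x ((ract k A a).lTensor V t) := by
  induction t using TensorProduct.induction_on with
  | zero => simp
  | tmul w d => exact congrArg (BalTensor.mk k A w) (mul_smul (op a) (op d) x).symm
  | add s t hs ht => simp only [map_add, smul_add, hs, ht]

lemma insertRight_hom (f : X ⟶ Y) (x : X) (t : V ⊗[k] A) :
    insertRight V (f.toLin x) t = (tensorMap (𝟙 V) f).toLin (insertRight V x t) := by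
  induction t using TensorProduct.induction_on with
  | zero => simp
  | tmul w d =>
    exact congrArg (BalTensor.mk k A w) (f.map_smul_right d x).symm
  | add s t hs ht => simp only [map_add, hs, ht]

lemma insertRight_rTensor (f : V ⟶ W) (x : X) (t : V ⊗[k] A) :
    insertRight W x (f.toLin.rTensor A t) = (tensorMap f (𝟙 X)).toLin (insertRight V x t) := by
  induction t using TensorProduct.induction_on with
  | zero => simp
  | tmul w d => rfl
  | add s t hs ht => simp only [map_add, hs, ht]

lemma rightUnitIso_insertRight (a : A) (t : V ⊗[k] A) :
    (rightUnitIso V).hom.toLin (insertRight V (X := unit) a t) =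
      actionMap k A V ((lact k A a).lTensor V t) := by
  induction t using TensorProduct.induction_on with
  | zero => simp
  | tmul w d => rfl
  | add s t hs ht => simp only [map_add, hs, ht]

/-- The map `w ⊗ b ⊗ a ↦ w ⊗ x b ⊗ y a`. -/
noncomputable def insertRight₂ (V : Bimodule k A) (x : X) (y : Y) :
    (V ⊗[k] A) ⊗[k] A →ₗ[k] tensor V (tensor X Y) :=
  (assocHom V X Y).toLin ∘ₗ insertRight (tensor V X) y ∘ₗ (insertRight V x).rTensor A

lemma insertRight₂_insert_one (x : X) (y : Y) (t : V ⊗[k] A) :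
    insertRight₂ V x y (((TensorProduct.mk k V A).flip 1).rTensor A t) =
      insertRight V (X := tensor X Y) (BalTensor.mk k A x y) t := by
  induction t using TensorProduct.induction_on with
  | zero => simp
  | tmul w d =>
    have h := congrArg (fun x => (assocHom V X Y).toLin
      (BalTensor.mk k A (V := tensor V X) (BalTensor.mk k A w x) (op d • y))) (one_smul Aᵐᵒᵖ x)
    exact h
  | add s t hs ht => simp only [map_add, hs, ht]

/-- The path is `x ⊗ y ⊗ v ↦ x ⊗ v₀ ⊗ y v₁ ↦ v₀₀ ⊗ x v₀₁ ⊗ y v₁`, so the coaction is applied twice.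
Only the formula for `c` is assumed, so the lemma serves both to verify the tensor axiom and to
exploit it. -/
lemma hexagon_apply (ρ : V →ₗ[k] V ⊗[k] A) (cX : tensor X V ⟶ tensor V X)
    (cY : tensor Y V ⟶ tensor V Y)
    (hX : ∀ x v, cX.toLin (BalTensor.mk k A x v) = insertRight V x (ρ v))
    (hY : ∀ y v, cY.toLin (BalTensor.mk k A y v) = insertRight V y (ρ v)) (x : X) (y : Y) (v : V) :
    (assocHom X Y V ≫ tensorMap (𝟙 X) cY ≫ assocInv X V Y ≫ tensorMap cX (𝟙 Y) ≫
      assocHom V X Y).toLin (BalTensor.mk k A (V := tensor X Y) (BalTensor.mk k A x y) v) =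
      insertRight₂ V x y (ρ.rTensor A (ρ v)) := by
  change (assocHom V X Y).toLin ((tensorMap cX (𝟙 Y)).toLin ((assocInv X V Y).toLin
    (BalTensor.mk k A (W := tensor V Y) x (cY.toLin (BalTensor.mk k A y v))))) = _
  rw [hY]
  generalize ρ v = t
  induction t using TensorProduct.induction_on with
  | zero => simp
  | tmul w d =>
    exact congrArg (fun z => (assocHom V X Y).toLin
      (BalTensor.mk k A (V := tensor V X) z (op d • y))) (hX x w)
  | add s t hs ht => simp only [map_add, hs, ht]

variable (k A) in
/-- The module `A ⊗ A` underlying the free bimodule. -/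
def FreeCarrier : Type v := A ⊗[k] A

noncomputable instance : AddCommGroup (FreeCarrier k A) := inferInstanceAs (AddCommGroup (A ⊗[k] A))

noncomputable instance : Module k (FreeCarrier k A) := inferInstanceAs (Module k (A ⊗[k] A))

noncomputable instance : Module A (FreeCarrier k A) :=
  Module.compHom (A ⊗[k] A)
    ((Module.End.rTensorAlgHom k A A).comp (Algebra.lsmul k k A : A →ₐ[k] _)).toRingHom

-- The standard `Aᵐᵒᵖ`-action on `A ⊗ A` is through the left factor; the type synonym makes room for
-- the action on the right factor.
noncomputable instance : Module Aᵐᵒᵖ (FreeCarrier k A) :=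
  Module.compHom (A ⊗[k] A)
    ((Module.End.lTensorAlgHom k A A).comp (Algebra.lsmul k k A : Aᵐᵒᵖ →ₐ[k] _)).toRingHom

variable (k A) in
/-- The bimodule `A ⊗ A` with the outer actions. -/
noncomputable def free : Bimodule k A where
  carrier := FreeCarrier k A
  towerLeft := ⟨fun c a t => by
    have h : (lact k A (V := A) (c • a)).rTensor A = c • (lact k A a).rTensor A := by
      simp [lact, LinearMap.rTensor_smul]
    exact LinearMap.congr_fun h t⟩
  towerRight := ⟨fun c a t => by
    have h : (ract k A (V := A) (c • a.unop)).lTensor A = c • (ract k A a.unop).lTensor A := by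
      simp [ract, LinearMap.lTensor_smul]
    exact LinearMap.congr_fun h t⟩
  smulComm := ⟨fun a b t => rTensor_lTensor_comm (lact k A a) (ract k A b.unop) t⟩

variable (k A) in
/-- The generator `1 ⊗ 1` of the free bimodule. -/
noncomputable def gen : free k A := (1 : A) ⊗ₜ[k] (1 : A)

/-- The map `a ⊗ b ↦ a x b`. -/
noncomputable def sandwich (x : X) : A ⊗[k] A →ₗ[k] X :=
  actionMap k A X ∘ₗ ((Algebra.lsmul k k X : A →ₐ[k] X →ₗ[k] X).toLinearMap.flip x).rTensor A

@[simp] lemma sandwich_tmul (x : X) (a b : A) : sandwich x (a ⊗ₜ[k] b) = op b • a • x := rfl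

/-- The homomorphism `a ⊗ b ↦ a x b` from the free bimodule. -/
noncomputable def ofFree (x : X) : free k A ⟶ X where
  toLin := sandwich x
  map_smul_left a t := by
    change sandwich x ((lact k A a).rTensor A t) = a • sandwich x t
    induction t using TensorProduct.induction_on with
    | zero => simp
    | tmul w d => simp [mul_smul, smul_comm a (op d)]
    | add s t hs ht => simp only [map_add, smul_add, hs, ht]
  map_smul_right a t := by
    change sandwich x ((ract k A a).lTensor A t) = op a • sandwich x t
    induction t using TensorProduct.induction_on with
    | zero => simp
    | tmul w d => simp [mul_smul]
    | add s t hs ht => simp only [map_add, smul_add, hs, ht]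

lemma ofFree_tmul (x : X) (a b : A) : (ofFree x).toLin (a ⊗ₜ[k] b) = op b • a • x := rfl

lemma ofFree_gen (x : X) : (ofFree x).toLin (gen k A) = x := by
  rw [gen, ofFree_tmul, op_one, one_smul, one_smul]

/-- The map `w ⊗ a ⊗ b ↦ w a ⊗ b`. -/
noncomputable def mulFirst (V : Bimodule k A) : V →ₗ[k] A ⊗[k] A →ₗ[k] V ⊗[k] A :=
  LinearMap.compr₂ (TensorProduct.mk k V (A ⊗[k] A))
    ((actionMap k A V).rTensor A ∘ₗ (TensorProduct.assoc k V A A).symm.toLinearMap)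

@[simp] lemma mulFirst_tmul (w : V) (a b : A) :
    mulFirst V w (a ⊗ₜ[k] b) = (op a • w) ⊗ₜ b := rfl

/-- The isomorphism `w ⊗ (a ⊗ b) ↦ w a ⊗ b` from `V ⊗_A (A ⊗ A)` to `V ⊗ A`. -/
noncomputable def contract (V : Bimodule k A) : tensor V (free k A) →ₗ[k] V ⊗[k] A :=
  BalTensor.lift (W := free k A) (mulFirst V) (fun w a t => by
    change mulFirst V (op a • w) t = mulFirst V w ((lact k A a).rTensor A t)
    induction t using TensorProduct.induction_on with
    | zero => simp
    | tmul b d => simp [mul_smul]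
    | add s t hs ht => simp only [map_add, hs, ht])

lemma contract_mk_tmul (w : V) (a b : A) :
    contract V (BalTensor.mk k A (W := free k A) w (a ⊗ₜ[k] b)) = (op a • w) ⊗ₜ b := rfl

lemma tensor_free_induction {p : tensor V (free k A) → Prop} (s : tensor V (free k A)) (zero : p 0)
    (mk : ∀ (w : V) (a b : A), p (BalTensor.mk k A (W := free k A) w (a ⊗ₜ[k] b)))
    (add : ∀ s t, p s → p t → p (s + t)) : p s := by
  induction s using BalTensor.induction with
  | zero => exact zero
  | mk w t =>
    induction t using TensorProduct.induction_on with
    | zero =>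
      have h : BalTensor.mk k A (W := free k A) w (0 : free k A) = 0 := map_zero _
      exact h ▸ zero
    | tmul a b => exact mk w a b
    | add s t hs ht =>
      have h : BalTensor.mk k A (W := free k A) w ((s : free k A) + (t : free k A)) = _ :=
        map_add _ _ _
      exact h ▸ add _ _ hs ht
  | add s t hs ht => exact add s t hs ht

lemma contract_smul (a : A) (s : tensor V (free k A)) :
    contract V (a • s) = (lact k A a).rTensor A (contract V s) := by
  induction s using tensor_free_induction with
  | zero => simp
  | mk w b d => exact congrArg (· ⊗ₜ[k] d) (smul_comm a (op b) w).symm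
  | add s t hs ht => simp only [map_add, smul_add, hs, ht]

lemma contract_op_smul (a : A) (s : tensor V (free k A)) :
    contract V (op a • s) = (ract k A a).lTensor V (contract V s) := by
  induction s using tensor_free_induction with
  | zero => simp
  | mk w b d => rfl
  | add s t hs ht => simp only [map_add, smul_add, hs, ht]

/-- This is the side of the naturality square along `ofFree x` that makes a natural transformation
computable from its value at the generator. -/
lemma tensorMap_ofFree (x : X) (s : tensor V (free k A)) :
    (tensorMap (𝟙 V) (ofFree x)).toLin s = insertRight V x (contract V s) := by
  induction s using tensor_free_induction with
  | zero => simp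
  | mk w b d =>
    rw [contract_mk_tmul, insertRight_tmul, BalTensor.mk_smul, smul_comm]
    rfl
  | add s t hs ht => simp only [map_add, hs, ht]

@[simp] lemma contract_insertRight_gen (t : V ⊗[k] A) :
    contract V (insertRight V (gen k A) t) = t := by
  induction t using TensorProduct.induction_on with
  | zero => simp
  | tmul w d =>
    refine (contract_mk_tmul w 1 (1 * d)).trans ?_
    rw [op_one, one_smul, one_mul]
  | add s t hs ht => simp only [map_add, hs, ht]

/-- Reassociating and contracting both free factors undoes the insertion. Hence the tensor axiom at
two free bimodules detects coassociativity. -/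
lemma insertRight₂_gen_injective :
    Function.Injective (insertRight₂ V (gen k A) (gen k A)) := by
  refine Function.LeftInverse.injective (g := (contract V).rTensor A ∘ₗ
    contract (tensor V (free k A)) ∘ₗ (assocInv V (free k A) (free k A)).toLin) fun t => ?_
  have h (s) : (assocInv V (free k A) (free k A)).toLin
      ((assocHom V (free k A) (free k A)).toLin s) = s :=
    LinearMap.congr_fun (congrArg Hom.toLin (α_ V (free k A) (free k A)).hom_inv_id) s
  have h' : contract V ∘ₗ insertRight V (gen k A) = LinearMap.id :=
    LinearMap.ext contract_insertRight_gen
  refine (congrArg (fun s => (contract V).rTensor A (contract (tensor V (free k A)) s))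
    (h (insertRight (tensor V (free k A)) (gen k A)
      ((insertRight V (gen k A)).rTensor A t)))).trans ?_
  refine (congrArg ((contract V).rTensor A)
    (contract_insertRight_gen (V := tensor V (free k A)) _)).trans ?_
  refine (LinearMap.rTensor_comp_apply A (contract V) (insertRight V (gen k A)) t).symm.trans ?_
  rw [h', LinearMap.rTensor_id, LinearMap.id_apply]

end Bimodule

/-! ### Yetter-Drinfeld modules and the weak right center -/

namespace YetterDrinfeld

open Bimodule

variable (V : YetterDrinfeld k A)

/-- The homomorphism `x ⊗ v ↦ ∑ v₀ ⊗ x v₁`. -/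
noncomputable def braid (X : Bimodule k A) : tensor X V.toBimodule ⟶ tensor V.toBimodule X where
  toLin := BalTensor.lift ((insertRight V.toBimodule).compl₂ V.coact) (fun x a v => by
    change insertRight V.toBimodule (op a • x) (V.coact v) =
      insertRight V.toBimodule x (V.coact (a • v))
    rw [insertRight_op_smul, V.coact_smul_left])
  map_smul_left a s := by
    induction s using BalTensor.induction with
    | zero => simp
    | mk x v =>
      change insertRight V.toBimodule (a • x) (V.coact v) =
        a • insertRight V.toBimodule x (V.coact v)
      rw [insertRight_smul, smul_insertRight, V.lact_coact]
    | add s t hs ht => rw [smul_add, map_add, map_add, smul_add, hs, ht]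
  map_smul_right a s := by
    induction s using BalTensor.induction with
    | zero => simp
    | mk x v =>
      change insertRight V.toBimodule x (V.coact (op a • v)) =
        op a • insertRight V.toBimodule x (V.coact v)
      rw [op_smul_insertRight, V.coact_smul_right]
    | add s t hs ht => rw [smul_add, map_add, map_add, smul_add, hs, ht]

lemma braid_mk {X : Bimodule k A} (x : X) (v : V.carrier) :
    (V.braid X).toLin (BalTensor.mk k A x v) = insertRight V.toBimodule x (V.coact v) := rfl

/-- The object of the weak right center given by a Yetter-Drinfeld module. -/
noncomputable abbrev toWeakRightCenter : WeakRightCenter (Bimodule k A) where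
  pt := V.toBimodule
  c :=
    { app := V.braid
      naturality X Y f := tensor_hom_ext fun x v => insertRight_hom f x (V.coact v) }
  -- Transported along the right unit isomorphism, the unit axiom reads `v₀ a v₁ = a v`.
  c_unit := (Iso.eq_comp_inv (rightUnitIso V.toBimodule)).2 (tensor_hom_ext fun a v =>
    (rightUnitIso_insertRight (V := V.toBimodule) a (V.coact v)).trans (V.smul_eq a v).symm)
  c_tensor X Y := tensor_hom_ext₃ fun x y v => by
    refine Eq.trans ?_ (hexagon_apply V.coact (V.braid X) (V.braid Y) V.braid_mk V.braid_mk
      x y v).symm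
    rw [V.coassoc, insertRight₂_insert_one]
    rfl

end YetterDrinfeld

namespace WeakRightCenter

open Bimodule

variable (W : WeakRightCenter (Bimodule k A))

/-- The component of the natural transformation at a bimodule. -/
abbrev braid (X : Bimodule k A) : tensor X W.pt ⟶ tensor W.pt X := W.c.app X

/-- The coaction `v ↦ c ((1 ⊗ 1) ⊗ v)`. -/
noncomputable def coact : W.pt →ₗ[k] W.pt ⊗[k] A :=
  contract W.pt ∘ₗ (W.braid (free k A)).toLin ∘ₗ BalTensor.mk k A (gen k A)

lemma coact_apply (v : W.pt) : W.coact v =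
    contract W.pt ((W.braid (free k A)).toLin (BalTensor.mk k A (gen k A) v)) := rfl

/-- Naturality along `ofFree x`, which carries the generator to `x`. -/
lemma braid_mk {X : Bimodule k A} (x : X) (v : W.pt) :
    (W.braid X).toLin (BalTensor.mk k A x v) = insertRight W.pt x (W.coact v) := by
  have h := LinearMap.congr_fun (congrArg Hom.toLin (W.c.naturality (ofFree x)))
    (BalTensor.mk k A (gen k A) v)
  refine Eq.trans ?_ (h.trans (tensorMap_ofFree x _))
  exact congrArg (fun y => (W.braid X).toLin (BalTensor.mk k A y v)) (ofFree_gen x).symm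

/-- The unit axiom, with `c` at the bimodule `A` evaluated by `braid_mk`. -/
lemma smul_eq (a : A) (v : W.pt) :
    a • v = actionMap k A W.pt ((lact k A a).lTensor W.pt (W.coact v)) := by
  have h := LinearMap.congr_fun (congrArg Hom.toLin
    ((Iso.eq_comp_inv (rightUnitIso W.pt)).1 W.c_unit)) (BalTensor.mk k A (V := A) a v)
  rw [← rightUnitIso_insertRight]
  refine h.symm.trans ?_
  exact congrArg (rightUnitIso W.pt).hom.toLin (W.braid_mk (X := unit) a v)

lemma coact_coassoc (v : W.pt) : W.coact.rTensor A (W.coact v) =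
    ((TensorProduct.mk k W.pt A).flip 1).rTensor A (W.coact v) := by
  apply insertRight₂_gen_injective
  rw [insertRight₂_insert_one]
  refine (hexagon_apply W.coact (W.braid _) (W.braid _) W.braid_mk W.braid_mk _ _ v).symm.trans ?_
  refine Eq.trans ?_ (W.braid_mk (X := tensor (free k A) (free k A)) _ v)
  exact (LinearMap.congr_fun (congrArg Hom.toLin (W.c_tensor (free k A) (free k A))) _).symm

/-- The Yetter-Drinfeld module of an object of the weak right center. -/
noncomputable abbrev toYetterDrinfeld : YetterDrinfeld k A where
  toBimodule := W.pt
  coact := W.coact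
  counit v := by
    have h := W.smul_eq 1 v
    have h' : lact k A (V := A) 1 = LinearMap.id := by
      ext w
      simp
    rw [h', LinearMap.lTensor_id, LinearMap.id_apply, one_smul] at h
    exact h.symm
  coassoc := W.coact_coassoc
  coact_smul_right a v := by
    rw [coact_apply, coact_apply, ← contract_op_smul, ← Hom.map_smul_right]
    rfl
  coact_smul_left a v := by
    -- Balancing gives `gen ⊗ a v = gen a ⊗ v`, and `braid_mk` evaluates `c` there.
    rw [coact_apply, ← BalTensor.mk_smul, braid_mk, insertRight_op_smul, contract_insertRight_gen]
  lact_coact a v := by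
    -- Both sides are the contraction of `c (a gen ⊗ v)`: `braid_mk` computes it as `v₀ a ⊗ v₁`,
    -- left linearity of `c` as `a v₀ ⊗ v₁`.
    have h := contract_insertRight_gen ((ract k A a).rTensor A (W.coact v))
    rw [← insertRight_smul, ← W.braid_mk] at h
    rw [← h, coact_apply, ← contract_smul, ← Hom.map_smul_left]
    rfl

lemma toWeakRightCenter_toYetterDrinfeld : W.toYetterDrinfeld.toWeakRightCenter = W := by
  have h : W.toYetterDrinfeld.toWeakRightCenter.c = W.c :=
    NatTrans.ext (funext fun X => tensor_hom_ext fun x v => (W.braid_mk x v).symm)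
  cases W
  exact Eq.mpr (WeakRightCenter.mk.injEq ..) ⟨rfl, heq_of_eq h⟩

end WeakRightCenter

namespace YetterDrinfeld

open Bimodule

variable (k A) in
/-- The functor from Yetter-Drinfeld modules to the weak right center. -/
noncomputable def toCenter : YetterDrinfeld k A ⥤ WeakRightCenter (Bimodule k A) where
  obj := toWeakRightCenter
  map {V W} f := ⟨f.toHom, fun X => tensor_hom_ext fun x v =>
    (congrArg (insertRight W.toBimodule x) (f.comm v)).trans
      (insertRight_rTensor (V := V.toBimodule) (W := W.toBimodule) f.toHom x (V.coact v))⟩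

instance : (toCenter k A).Faithful where
  map_injective h := Hom.ext (congrArg (fun f => f.hom.toLin) h)

/-- Compatibility with `c` at the free bimodule, evaluated at the generator and contracted, is
compatibility with `ρ`. -/
instance : (toCenter k A).Full where
  map_surjective {V W} f := ⟨⟨f.hom, fun v => by
    let φ : V.toBimodule ⟶ W.toBimodule := f.hom
    have h : insertRight W.toBimodule (gen k A) (W.coact (φ.toLin v)) =
        (tensorMap φ (𝟙 (free k A))).toLin (insertRight V.toBimodule (gen k A) (V.coact v)) :=
      LinearMap.congr_fun (congrArg Bimodule.Hom.toLin (f.comm (free k A)))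
        (BalTensor.mk k A (gen k A) v)
    rw [← insertRight_rTensor] at h
    have h' := congrArg (contract W.toBimodule) h
    rw [contract_insertRight_gen, contract_insertRight_gen] at h'
    exact h'⟩, rfl⟩

lemma toYetterDrinfeld_toWeakRightCenter (V : YetterDrinfeld k A) :
    V.toWeakRightCenter.toYetterDrinfeld = V := by
  have h : V.toWeakRightCenter.coact = V.coact :=
    LinearMap.ext fun v => contract_insertRight_gen (V := V.toBimodule) (V.coact v)
  cases V
  exact Eq.mpr (YetterDrinfeld.mk.injEq ..) ⟨rfl, heq_of_eq h⟩

lemma areIsomorphic_weakRightCenter :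
    AreIsomorphic (YetterDrinfeld k A) (WeakRightCenter (Bimodule k A)) :=
  .of_bijective (toCenter k A) WeakRightCenter.toYetterDrinfeld
    toYetterDrinfeld_toWeakRightCenter WeakRightCenter.toWeakRightCenter_toYetterDrinfeld

end YetterDrinfeld

/-! ### Invertibility of the half-braidings -/

namespace Bimodule

/-- A bimodule homomorphism with a `k`-linear inverse is an isomorphism. -/
lemma isIso_of_linear_inverse {V W : Bimodule k A} (f : V ⟶ W) (g : W →ₗ[k] V)
    (hgf : ∀ v, g (f.toLin v) = v) (hfg : ∀ w, f.toLin (g w) = w) : IsIso f :=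
  ⟨{ toLin := g
     map_smul_left a w := by
       conv_lhs => rw [← hfg w, ← f.map_smul_left, hgf]
     map_smul_right a w := by
       conv_lhs => rw [← hfg w, ← f.map_smul_right, hgf] },
    hom_ext hgf, hom_ext hfg⟩

/-- The map `w ⊗ a ↦ a x ⊗ w` from `V ⊗ A` to `X ⊗_A V`. -/
noncomputable def insertLeft (V : Bimodule k A) {X : Bimodule k A} :
    X →ₗ[k] V ⊗[k] A →ₗ[k] tensor X V :=
  (LinearMap.llcomp k (V ⊗[k] A) (X ⊗[k] V) (tensor X V) (BalTensor.proj k A)) ∘ₗ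
    LinearMap.lcomp k _ (TensorProduct.comm k V A).toLinearMap ∘ₗ
    LinearMap.rTensorHom V ∘ₗ (Algebra.lsmul k k X : A →ₐ[k] X →ₗ[k] X).toLinearMap.flip

variable {V X : Bimodule k A}

@[simp] lemma insertLeft_tmul (x : X) (w : V) (a : A) :
    insertLeft V x (w ⊗ₜ a) = BalTensor.mk k A (a • x) w := rfl

lemma insertLeft_smul (a : A) (x : X) (t : V ⊗[k] A) :
    insertLeft V (a • x) t = insertLeft V x ((ract k A a).lTensor V t) := by
  induction t using TensorProduct.induction_on with
  | zero => simp
  | tmul w d => exact congrArg (fun y => BalTensor.mk k A y w) (mul_smul d a x).symm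
  | add s t hs ht => simp only [map_add, hs, ht]

/-- The map `w ⊗ b ⊗ a ↦ w ⊗ a x b` from `V ⊗ A ⊗ A` to `V ⊗_A X`. -/
noncomputable def insertRightLeft (V : Bimodule k A) (x : X) :
    (V ⊗[k] A) ⊗[k] A →ₗ[k] tensor V X :=
  TensorProduct.lift (((insertRight V) ∘ₗ
    (Algebra.lsmul k k X : A →ₐ[k] X →ₗ[k] X).toLinearMap.flip x).flip)

/-- The map `w ⊗ b ⊗ a ↦ b x a ⊗ w` from `V ⊗ A ⊗ A` to `X ⊗_A V`. -/
noncomputable def insertLeftRight (V : Bimodule k A) (x : X) :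
    (V ⊗[k] A) ⊗[k] A →ₗ[k] tensor X V :=
  TensorProduct.lift (((insertLeft V) ∘ₗ TensorProduct.curry (actionMap k A X) x).flip)

end Bimodule

namespace YetterDrinfeld

open Bimodule

variable (V : YetterDrinfeld k A)

/-- The map `v ⊗ x ↦ ∑ v₁ x ⊗ v₀`. -/
noncomputable def braidInv (X : Bimodule k A) :
    tensor V.toBimodule X →ₗ[k] tensor X V.toBimodule :=
  BalTensor.lift ((insertLeft V.toBimodule).compl₂ V.coact).flip (fun v a x => by
    change insertLeft V.toBimodule x (V.coact (op a • v)) =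
      insertLeft V.toBimodule (a • x) (V.coact v)
    rw [insertLeft_smul, V.coact_smul_right])

lemma braidInv_mk {X : Bimodule k A} (v : V.carrier) (x : X) :
    V.braidInv X (BalTensor.mk k A v x) = insertLeft V.toBimodule x (V.coact v) := rfl

lemma braid_insertLeft {X : Bimodule k A} (x : X) (t : V.carrier ⊗[k] A) :
    (V.braid X).toLin (insertLeft V.toBimodule x t) =
      insertRightLeft V.toBimodule x (V.coact.rTensor A t) := by
  induction t using TensorProduct.induction_on with
  | zero => simp
  | tmul w a => rfl
  | add s t hs ht => simp only [map_add, hs, ht]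

lemma braidInv_insertRight {X : Bimodule k A} (x : X) (t : V.carrier ⊗[k] A) :
    V.braidInv X (insertRight V.toBimodule x t) =
      insertLeftRight V.toBimodule x (V.coact.rTensor A t) := by
  induction t using TensorProduct.induction_on with
  | zero => simp
  | tmul w a => rfl
  | add s t hs ht => simp only [map_add, hs, ht]

/-- The composite is `v ⊗ x ↦ v₁ x ⊗ v₀ ↦ v₀₀ ⊗ v₁ x v₀₁`, which is `v₀ ⊗ v₁ x = v₀ v₁ ⊗ x` by
coassociativity and balancing. -/
lemma braid_braidInv {X : Bimodule k A} (s : tensor V.toBimodule X) :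
    (V.braid X).toLin (V.braidInv X s) = s := by
  induction s using BalTensor.induction with
  | zero => simp
  | mk v x =>
    have h (t : V.carrier ⊗[k] A) : insertRightLeft V.toBimodule x
        (((TensorProduct.mk k V.carrier A).flip 1).rTensor A t) =
        BalTensor.mk k A (actionMap k A V.carrier t) x := by
      induction t using TensorProduct.induction_on with
      | zero => simp
      | tmul w a =>
        refine Eq.trans ?_ (BalTensor.mk_smul k A w a x).symm
        exact congrArg (BalTensor.mk k A w) (one_smul Aᵐᵒᵖ (a • x))
      | add s t hs ht => simp only [map_add, LinearMap.add_apply, hs, ht]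
    rw [braidInv_mk, braid_insertLeft, V.coassoc, h, V.counit]
  | add s t hs ht => rw [map_add, map_add, hs, ht]

/-- The map `w ⊗ a ↦ a w`. -/
noncomputable def leftActionMap : V.carrier ⊗[k] A →ₗ[k] V.carrier :=
  TensorProduct.lift (Algebra.lsmul k k V.carrier : A →ₐ[k] _).toLinearMap.flip

@[simp] lemma leftActionMap_tmul (w : V.carrier) (a : A) :
    V.leftActionMap (w ⊗ₜ a) = a • w := rfl

/-- `∑ v₁ v₀ = v` -/
lemma leftActionMap_coact (v : V.carrier) : V.leftActionMap (V.coact v) = v := by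
  -- The map `κ` is `w ⊗ b ⊗ a ↦ w a b`. Then `v₁ v₀ = v₀₀ v₁ v₀₁ = κ(v₀₀ ⊗ v₀₁ ⊗ v₁)`, and
  -- coassociativity reduces this to `v₀ v₁ = v`.
  let κ : (V.carrier ⊗[k] A) ⊗[k] A →ₗ[k] V.carrier := TensorProduct.lift
    (LinearMap.llcomp k _ _ _ (actionMap k A V.carrier) ∘ₗ LinearMap.lTensorHom V.carrier ∘ₗ
      (Algebra.lsmul k k A : A →ₐ[k] A →ₗ[k] A).toLinearMap).flip
  have h₁ (t : V.carrier ⊗[k] A) : V.leftActionMap t = κ (V.coact.rTensor A t) := by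
    induction t using TensorProduct.induction_on with
    | zero => simp
    | tmul w a => exact V.smul_eq a w
    | add s t hs ht => simp only [map_add, hs, ht]
  have h₂ (t : V.carrier ⊗[k] A) :
      κ (((TensorProduct.mk k V.carrier A).flip 1).rTensor A t) = actionMap k A V.carrier t := by
    induction t using TensorProduct.induction_on with
    | zero => simp
    | tmul w a => exact congrArg (fun b => op b • w) (mul_one a)
    | add s t hs ht => simp only [map_add, hs, ht]
  rw [h₁, V.coassoc, h₂, V.counit]

/-- The composite is `x ⊗ v ↦ v₀ ⊗ x v₁ ↦ v₀₁ x v₁ ⊗ v₀₀`, which is `x v₁ ⊗ v₀ = x ⊗ v₁ v₀`. -/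
lemma braidInv_braid {X : Bimodule k A} (s : tensor X V.toBimodule) :
    V.braidInv X ((V.braid X).toLin s) = s := by
  induction s using BalTensor.induction with
  | zero => simp
  | mk x v =>
    have h (t : V.carrier ⊗[k] A) : insertLeftRight V.toBimodule x
        (((TensorProduct.mk k V.carrier A).flip 1).rTensor A t) =
        BalTensor.mk k A x (V.leftActionMap t) := by
      induction t using TensorProduct.induction_on with
      | zero => simp
      | tmul w a =>
        refine Eq.trans ?_ (BalTensor.mk_smul k A x a w)
        exact congrArg (fun y => BalTensor.mk k A y w) (one_smul A (op a • x))
      | add s t hs ht => simp only [map_add, hs, ht]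
    rw [braid_mk, braidInv_insertRight, V.coassoc, h, leftActionMap_coact]
  | add s t hs ht => rw [map_add, map_add, hs, ht]

instance (X : Bimodule k A) : IsIso (V.braid X) :=
  isIso_of_linear_inverse _ (V.braidInv X) V.braidInv_braid V.braid_braidInv

end YetterDrinfeld

lemma WeakRightCenter.isIso_c (W : WeakRightCenter (Bimodule k A)) : IsIso W.c := by
  rw [← W.toWeakRightCenter_toYetterDrinfeld]
  have (X : Bimodule k A) : IsIso (W.toYetterDrinfeld.toWeakRightCenter.c.app X) :=
    inferInstanceAs (IsIso (W.toYetterDrinfeld.braid X))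
  exact NatIso.isIso_of_isIso_app _

/-! ### Faithfully flat descent -/

section Amitsur

variable (k A) in
/-- The map `m ⊗ a ↦ m ⊗ a ⊗ 1 - m ⊗ 1 ⊗ a`. -/
noncomputable def amitsur (M : Type*) [AddCommGroup M] [Module k M] :
    M ⊗[k] A →ₗ[k] (M ⊗[k] A) ⊗[k] A :=
  (TensorProduct.mk k (M ⊗[k] A) A).flip 1 - ((TensorProduct.mk k M A).flip 1).rTensor A

variable (M : Type*) [AddCommGroup M] [Module k M] [Module.FaithfullyFlat k A]

/-- Faithful flatness reflects exactness, and after tensoring with `A` the multiplication `A ⊗ A →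
A` provides a contraction. -/
lemma amitsur_exact :
    Function.Exact ((TensorProduct.mk k M A).flip 1) (amitsur k A M) := by
  refine Module.FaithfullyFlat.rTensor_reflects_exact k A _ _ fun t => ⟨fun ht => ?_, ?_⟩
  · refine ⟨mulLast k A M t, ?_⟩
    -- The homotopy identity: `m ⊗ a ⊗ b` goes to `m ⊗ a ⊗ b - m ⊗ 1 ⊗ a b`, so an element of the
    -- kernel equals its contraction with `1` inserted.
    have h (s : (M ⊗[k] A) ⊗[k] A) :
        mulLast k A (M ⊗[k] A) ((amitsur k A M).rTensor A s) =
          s - ((TensorProduct.mk k M A).flip 1).rTensor A (mulLast k A M s) := by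
      induction s using TensorProduct.induction_on with
      | zero => simp
      | tmul x b =>
        induction x using TensorProduct.induction_on with
        | zero => simp
        | tmul m a => simp [amitsur, LinearMap.rTensor_tmul, TensorProduct.sub_tmul, -LinearMap.rTensor_sub]
        | add x y hx hy =>
          rw [TensorProduct.add_tmul, map_add, map_add, map_add, map_add, hx, hy]
          abel
      | add x y hx hy =>
        rw [map_add, map_add, map_add, map_add, hx, hy]
        abel
    have h' := h t
    rw [ht, map_zero] at h'
    exact (sub_eq_zero.1 h'.symm).symm
  · rintro ⟨s, rfl⟩
    rw [← LinearMap.rTensor_comp_apply]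
    have h : amitsur k A M ∘ₗ (TensorProduct.mk k M A).flip 1 = 0 := by
      ext m
      simp [amitsur]
    rw [h, LinearMap.rTensor_zero, LinearMap.zero_apply]

lemma tmul_one_injective : Function.Injective ((TensorProduct.mk k M A).flip 1) := by
  refine (injective_iff_map_eq_zero _).2 fun m hm => ?_
  refine (Module.FaithfullyFlat.one_tmul_eq_zero_iff (R := k) (M := M) (A := A) m).1 ?_
  exact (TensorProduct.comm k A M).injective (by simpa using hm)

end Amitsur

namespace SweedlerComodule

/-- A bijective morphism of comodules is an isomorphism. -/
noncomputable def isoOfBijective {V W : SweedlerComodule k A} (f : V ⟶ W)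
    (hf : Function.Bijective f.toLin) : V ≅ W :=
  let e := LinearEquiv.ofBijective f.toLin hf
  have he (v) : f.toLin (e.symm v) = v := e.apply_symm_apply v
  { hom := f
    inv :=
      { toLin := e.symm.toLinearMap
        map_smul_right a v := hf.1 <| by
          rw [f.map_smul_right]
          exact (he _).trans (congrArg (op a • ·) (he v)).symm
        comm v := by
          have h := f.comm (e.symm v)
          rw [he] at h
          rw [h, ← LinearMap.rTensor_comp_apply]
          have h' : e.symm.toLinearMap ∘ₗ f.toLin = LinearMap.id :=
            LinearMap.ext e.symm_apply_apply
          rw [h', LinearMap.rTensor_id]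
          rfl }
    hom_inv_id := Hom.ext (LinearMap.ext e.symm_apply_apply)
    inv_hom_id := Hom.ext (LinearMap.ext e.apply_symm_apply) }

variable (k A) in
/-- The module `N ⊗ A` underlying the comodule induced from `N`. -/
def Induced (N : Type v) [AddCommGroup N] [Module k N] : Type v := N ⊗[k] A

section Induced

variable (N : Type v) [AddCommGroup N] [Module k N]

noncomputable instance : AddCommGroup (Induced k A N) := inferInstanceAs (AddCommGroup (N ⊗[k] A))

noncomputable instance : Module k (Induced k A N) := inferInstanceAs (Module k (N ⊗[k] A))

noncomputable instance : Module Aᵐᵒᵖ (Induced k A N) :=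
  Module.compHom (N ⊗[k] A)
    ((Module.End.lTensorAlgHom k A N).comp (Algebra.lsmul k k A : Aᵐᵒᵖ →ₐ[k] _)).toRingHom

/-- The comodule `N ⊗ A` with coaction `n ⊗ a ↦ n ⊗ 1 ⊗ a`. -/
noncomputable def induced : SweedlerComodule k A where
  carrier := Induced k A N
  towerRight := ⟨fun c a t => by
    have h : (ract k A (V := A) (c • a.unop)).lTensor N = c • (ract k A a.unop).lTensor N := by
      simp [ract, LinearMap.lTensor_smul]
    exact LinearMap.congr_fun h t⟩
  coact := ((TensorProduct.mk k N A).flip 1).rTensor A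
  counit t := by
    induction t using TensorProduct.induction_on with
    | zero => exact map_zero _
    | tmul n a => exact congrArg (n ⊗ₜ[k] ·) (one_mul a)
    | add s t hs ht =>
      exact (congrArg _ (map_add _ s t)).trans ((map_add _ _ _).trans (congrArg₂ _ hs ht))
  coassoc t := by
    refine (LinearMap.rTensor_comp_apply A (((TensorProduct.mk k N A).flip 1).rTensor A)
      ((TensorProduct.mk k N A).flip 1) t).symm.trans ?_
    refine Eq.trans ?_ (LinearMap.rTensor_comp_apply A ((TensorProduct.mk k (N ⊗[k] A) A).flip 1)
      ((TensorProduct.mk k N A).flip 1) t)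
    congr 2
  coact_smul_right a t := rTensor_lTensor_comm _ (ract k A a) t

end Induced

variable (k A) in
/-- The induction functor `N ↦ N ⊗ A`. -/
noncomputable def induction : ModuleCat.{v} k ⥤ SweedlerComodule k A where
  obj N := induced N
  map {N M} f :=
    { toLin := f.hom.rTensor A
      map_smul_right a t := rTensor_lTensor_comm f.hom (ract k A a) t
      comm t := by
        refine (LinearMap.rTensor_comp_apply A ((TensorProduct.mk k M A).flip 1)
          f.hom t).symm.trans ?_
        refine Eq.trans ?_ (LinearMap.rTensor_comp_apply A (f.hom.rTensor A)
          ((TensorProduct.mk k N A).flip 1) t)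
        congr 2 }
  map_id N := Hom.ext (LinearMap.rTensor_id A N)
  map_comp f g := Hom.ext (LinearMap.rTensor_comp A g.hom f.hom)

section Coinvariants

variable (V : SweedlerComodule k A)

/-- The coinvariants of a comodule: the elements `v` with `ρ(v) = v ⊗ 1`. -/
noncomputable def coinvariants : Submodule k V.carrier :=
  LinearMap.ker (V.coact - (TensorProduct.mk k V.carrier A).flip 1)

/-- The map `n ⊗ a ↦ n a` on the coinvariants. -/
noncomputable def coinvariantsMap : V.coinvariants ⊗[k] A →ₗ[k] V.carrier :=
  actionMap k A V.carrier ∘ₗ V.coinvariants.subtype.rTensor A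

@[simp] lemma coinvariantsMap_tmul (n : V.coinvariants) (a : A) :
    V.coinvariantsMap (n ⊗ₜ a) = op a • (n : V.carrier) := rfl

/-- Since `ρ(n) = n ⊗ 1`, right linearity gives `ρ(n a) = n ⊗ a`. For flat `A` this makes
`coinvariantsMap` injective. -/
lemma coact_coinvariantsMap (t : V.coinvariants ⊗[k] A) :
    V.coact (V.coinvariantsMap t) = V.coinvariants.subtype.rTensor A t := by
  induction t using TensorProduct.induction_on with
  | zero => simp
  | tmul n a =>
    have hn : V.coact n.1 = n.1 ⊗ₜ 1 := sub_eq_zero.1 n.2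
    simp [V.coact_smul_right, hn]
  | add s t hs ht => simp only [map_add, hs, ht]

/-- The morphism `n ⊗ a ↦ n a` from the comodule induced from the coinvariants. -/
noncomputable def coinvariantsHom : induced V.coinvariants ⟶ V where
  toLin := V.coinvariantsMap
  map_smul_right a t := by
    change V.coinvariantsMap ((ract k A a).lTensor _ t) = op a • V.coinvariantsMap t
    induction t using TensorProduct.induction_on with
    | zero => simp
    | tmul n b => exact mul_smul (op a) (op b) n.1
    | add s t hs ht => simp only [map_add, smul_add, hs, ht]
  comm t := by
    refine (V.coact_coinvariantsMap t).trans ?_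
    refine Eq.trans ?_ (LinearMap.rTensor_comp_apply A V.coinvariantsMap
      ((TensorProduct.mk k V.coinvariants A).flip 1) t)
    congr 2
    ext n
    simp

end Coinvariants

variable [Module.FaithfullyFlat k A]

instance : (induction k A).Faithful where
  map_injective {_ M _ _} h := ModuleCat.hom_ext <| LinearMap.ext fun n =>
    tmul_one_injective M (LinearMap.congr_fun (congrArg Hom.toLin h) (n ⊗ₜ[k] (1 : A)))

instance : (induction k A).Full where
  map_surjective {N M} φ := by
    let i : M →ₗ[k] M ⊗[k] A := (TensorProduct.mk k M A).flip 1
    let F : N ⊗[k] A →ₗ[k] M ⊗[k] A := φ.toLin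
    -- The element `n ⊗ 1` is coinvariant, hence so is its image; by `amitsur_exact` the
    -- coinvariants of `M ⊗ A` are exactly the `m ⊗ 1`.
    have h (n : N) : F (n ⊗ₜ 1) ∈ LinearMap.range i := by
      refine (amitsur_exact (A := A) M _).1 ?_
      have h' : i.rTensor A (F (n ⊗ₜ 1)) = F (n ⊗ₜ 1) ⊗ₜ 1 := φ.comm (n ⊗ₜ[k] (1 : A))
      exact sub_eq_zero.2 h'.symm
    let e := LinearEquiv.ofInjective i (tmul_one_injective M)
    let f : N →ₗ[k] M := e.symm.toLinearMap ∘ₗ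
      (F ∘ₗ (TensorProduct.mk k N A).flip 1).codRestrict (LinearMap.range i) h
    have hf (n : N) : f n ⊗ₜ[k] (1 : A) = F (n ⊗ₜ 1) :=
      congrArg Subtype.val (e.apply_symm_apply ⟨F (n ⊗ₜ 1), h n⟩)
    refine ⟨ModuleCat.ofHom f, Hom.ext (TensorProduct.ext' fun n a => ?_)⟩
    have h₁ : F (n ⊗ₜ (1 * a)) = (ract k A a).lTensor M (F (n ⊗ₜ 1)) :=
      φ.map_smul_right a (n ⊗ₜ[k] (1 : A))
    rw [← hf, one_mul] at h₁
    exact ((h₁.trans (congrArg (f n ⊗ₜ[k] ·) (one_mul a))).symm :)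

/-- Coassociativity places `ρ(v)` in the kernel of `(ρ - (· ⊗ 1)) ⊗ A`, which by flatness is the
image of coinvariants tensored with `A`; the counit then returns `v`, whence surjectivity. -/
lemma coinvariantsHom_bijective (V : SweedlerComodule k A) :
    Function.Bijective V.coinvariantsHom.toLin := by
  refine ⟨fun s t hst => ?_, fun v => ?_⟩
  · refine Module.Flat.rTensor_preserves_injective_linearMap V.coinvariants.subtype
      V.coinvariants.subtype_injective ?_
    exact (V.coact_coinvariantsMap s).symm.trans
      ((congrArg V.coact hst).trans (V.coact_coinvariantsMap t))
  · have hex := Module.Flat.rTensor_exact A (LinearMap.exact_subtype_ker_map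
      (V.coact - (TensorProduct.mk k V.carrier A).flip 1))
    obtain ⟨t, ht⟩ := (hex (V.coact v)).1 (by
      rw [LinearMap.rTensor_sub, LinearMap.sub_apply, V.coassoc, sub_self])
    exact ⟨t, (congrArg (actionMap k A V.carrier) ht).trans (V.counit v)⟩

instance : (induction k A).EssSurj where
  mem_essImage V := ⟨ModuleCat.of k _, ⟨isoOfBijective _ V.coinvariantsHom_bijective⟩⟩

instance : (induction k A).IsEquivalence where

lemma nonempty_equivalence : Nonempty (SweedlerComodule k A ≌ ModuleCat.{v} k) :=
  ⟨(induction k A).asEquivalence.symm⟩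

end SweedlerComodule

end BimoduleCenter

theorem mainTheorem1 (k : Type u) (A : Type v) [CommRing k] [Ring A] [Algebra k A] :
    (AreIsomorphic (DescentDatum k A) (YetterDrinfeld k A) ∧
      AreIsomorphic (YetterDrinfeld k A) (SweedlerComodule k A) ∧
      AreIsomorphic (SweedlerComodule k A) (WeakRightCenter (Bimodule k A)) ∧
      AreIsomorphic (WeakRightCenter (Bimodule k A)) (RightCenter (Bimodule k A))) ∧
    (Module.FaithfullyFlat k A →
      Nonempty (DescentDatum k A ≌ ModuleCat.{v} k) ∧
      Nonempty (YetterDrinfeld k A ≌ ModuleCat.{v} k) ∧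
      Nonempty (SweedlerComodule k A ≌ ModuleCat.{v} k) ∧
      Nonempty (WeakRightCenter (Bimodule k A) ≌ ModuleCat.{v} k) ∧
      Nonempty (RightCenter (Bimodule k A) ≌ ModuleCat.{v} k)) := by
  have h₁ := (YetterDrinfeld.areIsomorphic_descentDatum (k := k) (A := A)).symm
  have h₂ := YetterDrinfeld.areIsomorphic_sweedlerComodule (k := k) (A := A)
  have h₃ := h₂.symm.trans (YetterDrinfeld.areIsomorphic_weakRightCenter (k := k) (A := A))
  have h₄ := areIsomorphic_rightCenter (WeakRightCenter.isIso_c (k := k) (A := A))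
  refine ⟨⟨h₁, h₂, h₃, h₄⟩, fun _ => ?_⟩
  obtain ⟨e⟩ := SweedlerComodule.nonempty_equivalence (k := k) (A := A)
  obtain ⟨e₁⟩ := (h₁.trans h₂).nonempty_equivalence
  obtain ⟨e₂⟩ := h₂.nonempty_equivalence
  obtain ⟨e₃⟩ := h₃.symm.nonempty_equivalence
  obtain ⟨e₄⟩ := (h₃.trans h₄).symm.nonempty_equivalence
  exact ⟨⟨e₁.trans e⟩, ⟨e₂.trans e⟩, ⟨e⟩, ⟨e₃.trans e⟩, ⟨e₄.trans e⟩⟩
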